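/- Let $\Phi:(0,\infty)\to\mathbb{R}$ be a smooth function with $\Phi>0$, $\Phi'>0$ and $\Phi''(x)\ge -2\Phi'(x)/x$ for all $x>0$. Put $G(x)=\int_0^x \frac{ds}{\Phi(1/s)}$ for $x\ge 0$; this is a strictly increasing bijection of $[0,\infty)$ onto itself, with inverse $G^{-1}$. Let $n\ge 1$, let $M^n$ be a smooth compact manifold without boundary, let $0<T<\infty$, and let $X:M^n\times[0,T)\to\mathbb{R}^{n+1}$ be a $\Phi(H)$-flow, that is, a smooth family of immersions $X(\cdot,t)$ with smooth outer unit normal $\nu(\cdot,t)$ and with $$\frac{\partial X}{\partial t}(p,t)=-\Phi(H(p,t))\,\nu(p,t),\qquad (p,t)\in M^n\times[0,T).$$ Here the Weingarten map $\mathcal{W}=\mathcal{W}(p,t):T_pM\to T_pM$ is given by $dX(\mathcal{W}v)=d\nu(v)$, its eigenvalues are the principal curvatures, $H=\operatorname{tr}\mathcal{W}$, which is positive on $M^n\times[0,T)$ (so that $\Phi(H)$ is defined), and $|A|=\sqrt{\operatorname{tr}(\mathcal{W}^2)}$. Let $H_{\max}(0)=\max_{p\in M}H(p,0)$. Suppose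 that the initial hypersurface $X(\cdot,0)$ is strictly convex, i.e. all its principal curvatures are positive at every point. Then for all $p\in M^n$ and all $t\in[0,T)$ $$|A|(p,t)\le H(p,t),$$ and, if in addition $t<G\big(1/H_{\max}(0)\big)$, then $$H(p,t)\le \frac{1}{G^{-1}\Big(G\big(\tfrac{1}{H_{\max}(0)}\big)-t\Big)}.$$ -/

import Mathlib

open scoped Manifold ContDiff InnerProductSpace

noncomputable section

/-- Euclidean space `ℝᵏ`. -/
abbrev Euc (k : ℕ) : Type := EuclideanSpace ℝ (Fin k)

section Hypersurface

variable {n : ℕ} {M : Type*} [TopologicalSpace M] [ChartedSpace (Euc n) M]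

/-- The differential `T_pM → ℝⁿ⁺¹` at `p` of a map `F : M → ℝⁿ⁺¹`. -/
def diffAt (F : M → Euc (n + 1)) (p : M) : TangentSpace (𝓡 n) p →ₗ[ℝ] Euc (n + 1) :=
  (mfderiv (𝓡 n) 𝓘(ℝ, Euc (n + 1)) F p).toLinearMap

/-- The Weingarten map `𝒲 = 𝒲_{-ν} : T_pM → T_pM` of an immersion `F : M → ℝⁿ⁺¹` with unit normal
field `ν`, that is the endomorphism with `dF (𝒲 v) = dν v`. If `F` is an immersion then `dF_p` is
injective with image `ν(p)^⊥`, which contains the image of `dν_p`, so that `𝒲 = dF_p⁻¹ ∘ dν_p`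
does not depend on the choice of the left inverse. For the unit sphere with its outer normal,
`𝒲` is the identity. -/
def weingarten (F ν : M → Euc (n + 1)) (p : M) :
    TangentSpace (𝓡 n) p →ₗ[ℝ] TangentSpace (𝓡 n) p :=
  (diffAt F p).leftInverse ∘ₗ diffAt ν p

/-- The mean curvature `H = tr 𝒲`, the sum of the principal curvatures. -/
def meanCurvature (F ν : M → Euc (n + 1)) (p : M) : ℝ :=
  LinearMap.trace ℝ (TangentSpace (𝓡 n) p) (weingarten F ν p)

/-- The norm `|A|` of the second fundamental form, where `|A|² = hⁱⱼ hʲᵢ = tr (𝒲 ∘ 𝒲)` is the sum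
of the squares of the principal curvatures. -/
def normA (F ν : M → Euc (n + 1)) (p : M) : ℝ :=
  Real.sqrt (LinearMap.trace ℝ (TangentSpace (𝓡 n) p) (weingarten F ν p ∘ₗ weingarten F ν p))

/-- Strict convexity: all principal curvatures (eigenvalues of the Weingarten map) are positive. -/
def IsStrictlyConvex (F ν : M → Euc (n + 1)) : Prop :=
  ∀ p : M, ∀ κ : ℝ, Module.End.HasEigenvalue (weingarten F ν p) κ → 0 < κ

/-- `X : M × [0, T) → ℝⁿ⁺¹` is a smooth solution of the flow `∂X/∂t = -Φ(H) ν`, a family of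
immersions with unit normal `ν`. The speed `Φ` has the domain `(0, ∞)`, so `H > 0` is needed for
the equation to make sense; as `H` changes sign with `ν`, this also makes `ν` the outer normal.
At `t = 0` the time derivative is one-sided. -/
structure IsPhiFlow (Φ : ℝ → ℝ) (T : ℝ) (X ν : M → ℝ → Euc (n + 1)) : Prop where
  smooth : ContMDiffOn ((𝓡 n).prod 𝓘(ℝ, ℝ)) 𝓘(ℝ, Euc (n + 1)) ∞
    (fun q : M × ℝ => X q.1 q.2) (Set.univ ×ˢ Set.Ico 0 T)
  immersion : ∀ t ∈ Set.Ico 0 T, ∀ p : M, Function.Injective (diffAt (fun q => X q t) p)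
  normal_smooth : ContMDiffOn ((𝓡 n).prod 𝓘(ℝ, ℝ)) 𝓘(ℝ, Euc (n + 1)) ∞
    (fun q : M × ℝ => ν q.1 q.2) (Set.univ ×ˢ Set.Ico 0 T)
  normal_unit : ∀ t ∈ Set.Ico 0 T, ∀ p : M, ‖ν p t‖ = 1
  normal_orthogonal : ∀ t ∈ Set.Ico 0 T, ∀ p : M, ∀ v : TangentSpace (𝓡 n) p,
    ⟪ν p t, diffAt (fun q => X q t) p v⟫_ℝ = 0
  meanCurvature_pos : ∀ t ∈ Set.Ico 0 T, ∀ p : M,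
    0 < meanCurvature (fun q => X q t) (fun q => ν q t) p
  evolution : ∀ t ∈ Set.Ico 0 T, ∀ p : M,
    HasDerivWithinAt (fun s => X p s)
      (-(Φ (meanCurvature (fun q => X q t) (fun q => ν q t) p) • ν p t)) (Set.Ico 0 T) t

end Hypersurface

/-- The conditions on the speed function `Φ : (0, ∞) → ℝ`; values of `Φ` off `(0, ∞)` play no
role. -/
structure IsSpeed (Φ : ℝ → ℝ) : Prop where
  smooth : ContDiffOn ℝ ∞ Φ (Set.Ioi 0)
  pos : ∀ x, 0 < x → 0 < Φ x
  deriv_pos : ∀ x, 0 < x → 0 < deriv Φ x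
  deriv2_ge : ∀ x, 0 < x → -2 * deriv Φ x / x ≤ deriv (deriv Φ) x

/-- `G(x) = ∫₀ˣ ds / Φ(1/s)`, for `x ≥ 0`. -/
def speedG (Φ : ℝ → ℝ) (x : ℝ) : ℝ := ∫ s in (0 : ℝ)..x, 1 / Φ (1 / s)

/-- The inverse of the bijection `G : [0, ∞) → [0, ∞)`. -/
def speedGInv (Φ : ℝ → ℝ) : ℝ → ℝ := Function.invFunOn (speedG Φ) (Set.Ici 0)

namespace IsSpeed

variable {Φ : ℝ → ℝ}

theorem strictMonoOn (h : IsSpeed Φ) : StrictMonoOn Φ (Set.Ioi 0) :=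
  strictMonoOn_of_deriv_pos (convex_Ioi 0) h.smooth.continuousOn
    (by intro x hx; rw [interior_Ioi] at hx; exact h.deriv_pos x hx)

theorem integrand_mono (h : IsSpeed Φ) {s t : ℝ} (hs : 0 < s) (hst : s ≤ t) :
    1 / Φ (1 / s) ≤ 1 / Φ (1 / t) := by
  have ht : 0 < t := hs.trans_le hst
  apply one_div_le_one_div_of_le (h.pos _ (by positivity))
  exact h.strictMonoOn.monotoneOn (show 0 < 1 / t by positivity) (show 0 < 1 / s by positivity)
    (one_div_le_one_div_of_le hs hst)

theorem integrand_pos (h : IsSpeed Φ) {s : ℝ} (hs : 0 < s) : 0 < 1 / Φ (1 / s) :=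
  one_div_pos.2 (h.pos _ (one_div_pos.2 hs))

theorem integrable (h : IsSpeed Φ) {a b : ℝ} (ha : 0 ≤ a) (hab : a ≤ b) :
    IntervalIntegrable (fun s => 1 / Φ (1 / s)) MeasureTheory.volume a b := by
  have hm : MonotoneOn (fun s : ℝ => if 0 < s then 1 / Φ (1 / s) else 0) (Set.uIcc a b) := by
    intro s _ t _ hst
    by_cases hs : 0 < s
    · simp only [hs, hs.trans_le hst, if_true]
      exact h.integrand_mono hs hst
    · by_cases ht : 0 < t
      · simp only [hs, ht, if_true, if_false]
        exact (h.integrand_pos ht).le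
      · simp [hs, ht]
  refine hm.intervalIntegrable.congr ?_
  intro s hs
  rw [Set.uIoc_of_le hab] at hs
  simp [lt_of_le_of_lt ha hs.1]

theorem le_speedG_sub (h : IsSpeed Φ) {a b : ℝ} (ha : 0 < a) (hab : a ≤ b) :
    (b - a) * (1 / Φ (1 / a)) ≤ speedG Φ b - speedG Φ a := by
  have e : speedG Φ b - speedG Φ a = ∫ s in a..b, 1 / Φ (1 / s) :=
    intervalIntegral.integral_interval_sub_left (h.integrable le_rfl (ha.le.trans hab))
      (h.integrable le_rfl ha.le)
  rw [e]
  have := intervalIntegral.integral_mono_on (f := fun _ => 1 / Φ (1 / a)) hab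
    (by simp) (h.integrable ha.le hab) (fun s hs => h.integrand_mono ha hs.1)
  simpa using this

theorem speedG_pos (h : IsSpeed Φ) {b : ℝ} (hb : 0 < b) : 0 < speedG Φ b :=
  intervalIntegral.intervalIntegral_pos_of_pos_on (h.integrable le_rfl hb.le)
    (fun _ hs => h.integrand_pos hs.1) hb

/-- `G` maps `[0, ∞)` bijectively onto `[0, ∞)`, so `G⁻¹` makes sense. -/
theorem bijOn_speedG (h : IsSpeed Φ) : Set.BijOn (speedG Φ) (Set.Ici 0) (Set.Ici 0) := by
  have h0 : speedG Φ 0 = 0 := by simp [speedG]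
  have hs : StrictMonoOn (speedG Φ) (Set.Ici 0) := by
    intro a ha b _ hab
    rcases (Set.mem_Ici.1 ha).eq_or_lt with rfl | ha
    · rw [h0]; exact h.speedG_pos hab
    · have := h.le_speedG_sub ha hab.le
      have : 0 < (b - a) * (1 / Φ (1 / a)) := mul_pos (sub_pos.2 hab) (h.integrand_pos ha)
      linarith
  refine ⟨?_, hs.injOn, ?_⟩
  · intro x hx
    have := hs.monotoneOn (Set.mem_Ici.2 le_rfl) hx hx
    rwa [h0] at this
  · intro y hy
    have hp := h.integrand_pos one_pos
    have hq := h.speedG_pos one_pos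
    set c := 1 / Φ (1 / 1) with hc
    set b := 1 + y / c with hb
    have hb1 : 1 ≤ b := le_add_of_nonneg_right (div_nonneg hy hp.le)
    have hb0 : 0 ≤ b := zero_le_one.trans hb1
    have hle := h.le_speedG_sub one_pos hb1
    have : (b - 1) * c = y := by rw [hb]; field_simp; ring
    rw [← hc, this] at hle
    have hcont : ContinuousOn (speedG Φ) (Set.Icc 0 b) := by
      have := intervalIntegral.continuousOn_primitive_interval
        (μ := MeasureTheory.volume) (f := fun s => 1 / Φ (1 / s)) (a := 0) (b := b)
        ((intervalIntegrable_iff').1 (h.integrable le_rfl hb0))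
      rwa [Set.uIcc_of_le hb0] at this
    obtain ⟨x, hx, rfl⟩ := intermediate_value_Icc hb0 hcont
      (show y ∈ Set.Icc (speedG Φ 0) (speedG Φ b) from ⟨by rw [h0]; exact hy, by linarith⟩)
    exact ⟨x, hx.1, rfl⟩

theorem speedG_speedGInv (h : IsSpeed Φ) {y : ℝ} (hy : 0 ≤ y) :
    speedG Φ (speedGInv Φ y) = y :=
  h.bijOn_speedG.surjOn.rightInvOn_invFunOn hy

end IsSpeed

end

/-! By compactness the principal curvatures of the initial hypersurface exceed some constant `c >
0`, and the bound `κ ≥ c` persists. Let `h` be the second fundamental form, `g` the metric and `Q =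
h - c g`, and suppose that `Q ≥ 0` up to a time `t > 0` at which `Q` acquires a null vector `e_a`.
In normal coordinates `∂ₜ Q_aa = ∇_a∇_a Φ(H) + c² Φ(H)`, and Simons' identity gives `∇_a∇_a H = Δ
Q_aa +` a nonnegative term. Moving the null vector as well, to `e_a + m x_k e_k`, and summing the
second order conditions over `k` gives `Δ Q_aa + 4m ∇_a H + 2m² tr Q ≥ 0` by Codazzi. Since `tr Q ≤
H`, the choice `m = -∇_a H / H` yields `Δ Q_aa ≥ 2 (∇_a H)² / H`. This is what `Φ'' ≥ -2Φ'/x` needs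
in order that `∇_a∇_a Φ(H) ≥ 0`, hence `∂ₜ Q_aa ≥ c² Φ(H) > 0`, whereas minimality with respect to
earlier times forces `∂ₜ Q_aa ≤ 0`. This is `CoordFlow.not_null`; `IsPhiFlow.exists_curvatureGE`
turns it into a bound for all times.

With all `κ_i ≥ 0` we have `∑ κ_i² ≤ (∑ κ_i)²`, that is `|A| ≤ H`. At a spatial maximum of `H`
therefore `∂ₜ H ≤ Φ(H)|A|² ≤ Φ(H)H²`, which says that `G(1/H)` decreases at rate at most one,
because `G'(1/H) = 1/Φ(H)`. Comparison with time zero (`IsPhiFlow.speedG_le`) gives `G(1/H) ≥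
G(1/H_max(0)) - t`, and inverting `G` gives the bound on `H`. -/

noncomputable section

/-! ### Calculus of directional derivatives and conditions at a minimum. -/

section DirDeriv

variable {E F : Type*} [NormedAddCommGroup E] [NormedSpace ℝ E]
  [NormedAddCommGroup F] [InnerProductSpace ℝ F] {U : Set E} {z : E}

/-- The derivative of `f` in the direction of the constant vector field `w`. -/
def dirDeriv {E F : Type*} [NormedAddCommGroup E] [NormedSpace ℝ E]
    [NormedAddCommGroup F] [NormedSpace ℝ F] (w : E) (f : E → F) (z : E) : F :=
  fderiv ℝ f z w

theorem dirDeriv_contDiffOn (hU : IsOpen U) {f : E → F} (hf : ContDiffOn ℝ ∞ f U) (w : E) :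
    ContDiffOn ℝ ∞ (dirDeriv w f) U :=
  (hf.fderiv_of_isOpen hU (m := ∞) (by simp)).clm_apply contDiffOn_const

theorem differentiableAt_of_contDiffOn (hU : IsOpen U) (hz : z ∈ U) {f : E → F}
    (hf : ContDiffOn ℝ ∞ f U) : DifferentiableAt ℝ f z :=
  (hf.contDiffAt (hU.mem_nhds hz)).differentiableAt (by simp)

theorem dirDeriv_congr (hU : IsOpen U) (hz : z ∈ U) {f g : E → F} (h : ∀ y ∈ U, f y = g y)
    (w : E) : dirDeriv w f z = dirDeriv w g z := by
  have : f =ᶠ[nhds z] g := Filter.eventually_of_mem (hU.mem_nhds hz) h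
  rw [dirDeriv, dirDeriv, this.fderiv_eq]

theorem dirDeriv_comm (hU : IsOpen U) (hz : z ∈ U) {f : E → F} (hf : ContDiffOn ℝ ∞ f U)
    (v w : E) : dirDeriv v (dirDeriv w f) z = dirDeriv w (dirDeriv v f) z := by
  have hd : DifferentiableAt ℝ (fderiv ℝ f) z :=
    ((hf.fderiv_of_isOpen hU (m := ∞) (by simp)).contDiffAt (hU.mem_nhds hz)).differentiableAt
      (by simp)
  have key : ∀ u u' : E, dirDeriv u (dirDeriv u' f) z = fderiv ℝ (fderiv ℝ f) z u u' := by
    intro u u'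
    have : HasFDerivAt (fun y => fderiv ℝ f y u') ((fderiv ℝ (fderiv ℝ f) z).flip u') z := by
      have := hd.hasFDerivAt.clm_apply (hasFDerivAt_const u' z)
      simpa using this
    exact congrArg (fun l : E →L[ℝ] F => l u) this.fderiv
  rw [key, key]
  exact ((hf.contDiffAt (hU.mem_nhds hz)).isSymmSndFDerivAt (by
    rw [minSmoothness_of_isRCLikeNormedField]
    exact WithTop.coe_le_coe.2 (le_top : (2 : ℕ∞) ≤ ⊤))).eq v w

theorem dirDeriv_inner (hU : IsOpen U) (hz : z ∈ U) {f g : E → F} (hf : ContDiffOn ℝ ∞ f U)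
    (hg : ContDiffOn ℝ ∞ g U) (w : E) :
    dirDeriv w (fun y => ⟪f y, g y⟫_ℝ) z = ⟪dirDeriv w f z, g z⟫_ℝ + ⟪f z, dirDeriv w g z⟫_ℝ := by
  rw [dirDeriv, fderiv_inner_apply ℝ (differentiableAt_of_contDiffOn hU hz hf)
    (differentiableAt_of_contDiffOn hU hz hg), add_comm]
  rfl

theorem dirDeriv_smul (hU : IsOpen U) (hz : z ∈ U) {a : E → ℝ} {f : E → F}
    (ha : ContDiffOn ℝ ∞ a U) (hf : ContDiffOn ℝ ∞ f U) (w : E) :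
    dirDeriv w (fun y => a y • f y) z = dirDeriv w a z • f z + a z • dirDeriv w f z := by
  rw [dirDeriv, fderiv_fun_smul (differentiableAt_of_contDiffOn hU hz ha)
    (differentiableAt_of_contDiffOn hU hz hf), add_comm]
  rfl

theorem dirDeriv_mul (hU : IsOpen U) (hz : z ∈ U) {a f : E → ℝ}
    (ha : ContDiffOn ℝ ∞ a U) (hf : ContDiffOn ℝ ∞ f U) (w : E) :
    dirDeriv w (fun y => a y * f y) z = dirDeriv w a z * f z + a z * dirDeriv w f z :=
  dirDeriv_smul hU hz ha hf w

theorem dirDeriv_const_mul (hU : IsOpen U) (hz : z ∈ U) {f : E → ℝ} (c : ℝ)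
    (hf : ContDiffOn ℝ ∞ f U) (w : E) :
    dirDeriv w (fun y => c * f y) z = c * dirDeriv w f z := by
  rw [dirDeriv, fderiv_const_mul (differentiableAt_of_contDiffOn hU hz hf)]
  rfl

theorem dirDeriv_add (hU : IsOpen U) (hz : z ∈ U) {f g : E → F} (hf : ContDiffOn ℝ ∞ f U)
    (hg : ContDiffOn ℝ ∞ g U) (w : E) :
    dirDeriv w (fun y => f y + g y) z = dirDeriv w f z + dirDeriv w g z := by
  rw [dirDeriv, fderiv_fun_add (differentiableAt_of_contDiffOn hU hz hf)
    (differentiableAt_of_contDiffOn hU hz hg)]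
  rfl

theorem dirDeriv_sub (hU : IsOpen U) (hz : z ∈ U) {f g : E → F} (hf : ContDiffOn ℝ ∞ f U)
    (hg : ContDiffOn ℝ ∞ g U) (w : E) :
    dirDeriv w (fun y => f y - g y) z = dirDeriv w f z - dirDeriv w g z := by
  rw [dirDeriv, fderiv_fun_sub (differentiableAt_of_contDiffOn hU hz hf)
    (differentiableAt_of_contDiffOn hU hz hg)]
  rfl

theorem dirDeriv_neg (w : E) (f : E → F) (z : E) :
    dirDeriv w (fun y => -f y) z = -dirDeriv w f z := by
  rw [dirDeriv, fderiv_fun_neg]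
  rfl

theorem dirDeriv_const (w : E) (c : F) (z : E) : dirDeriv w (fun _ => c) z = 0 := by
  simp [dirDeriv]

theorem dirDeriv_clm (w : E) (l : E →L[ℝ] F) (z : E) : dirDeriv w l z = l w := by
  simp [dirDeriv]

theorem dirDeriv_sum {ι : Type*} (s : Finset ι) (hU : IsOpen U) (hz : z ∈ U) {f : ι → E → F}
    (hf : ∀ i, ContDiffOn ℝ ∞ (f i) U) (w : E) :
    dirDeriv w (fun y => ∑ i ∈ s, f i y) z = ∑ i ∈ s, dirDeriv w (f i) z := by
  rw [dirDeriv, fderiv_fun_sum (fun i _ => differentiableAt_of_contDiffOn hU hz (hf i))]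
  simp [dirDeriv]

theorem dirDeriv_dirDeriv_inner (hU : IsOpen U) (hz : z ∈ U) {f g : E → F}
    (hf : ContDiffOn ℝ ∞ f U) (hg : ContDiffOn ℝ ∞ g U) (w : E) :
    dirDeriv w (dirDeriv w (fun y => ⟪f y, g y⟫_ℝ)) z =
      ⟪dirDeriv w (dirDeriv w f) z, g z⟫_ℝ + 2 * ⟪dirDeriv w f z, dirDeriv w g z⟫_ℝ +
        ⟪f z, dirDeriv w (dirDeriv w g) z⟫_ℝ := by
  have hf' := dirDeriv_contDiffOn hU hf w
  have hg' := dirDeriv_contDiffOn hU hg w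
  rw [dirDeriv_congr hU hz (fun y hy => dirDeriv_inner hU hy hf hg w),
    dirDeriv_add hU hz (hf'.inner ℝ hg) (hf.inner ℝ hg'), dirDeriv_inner hU hz hf' hg,
    dirDeriv_inner hU hz hf hg']
  ring

theorem dirDeriv_dirDeriv_smul (hU : IsOpen U) (hz : z ∈ U) {a : E → ℝ} {f : E → F}
    (ha : ContDiffOn ℝ ∞ a U) (hf : ContDiffOn ℝ ∞ f U) (w : E) :
    dirDeriv w (dirDeriv w (fun y => a y • f y)) z =
      dirDeriv w (dirDeriv w a) z • f z + (2 * dirDeriv w a z) • dirDeriv w f z +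
        a z • dirDeriv w (dirDeriv w f) z := by
  have ha' := dirDeriv_contDiffOn hU ha w
  have hf' := dirDeriv_contDiffOn hU hf w
  rw [dirDeriv_congr hU hz (fun y hy => dirDeriv_smul hU hy ha hf w),
    dirDeriv_add hU hz (f := fun y => dirDeriv w a y • f y) (g := fun y => a y • dirDeriv w f y)
      (ha'.smul hf) (ha.smul hf'), dirDeriv_smul hU hz ha' hf,
    dirDeriv_smul hU hz ha hf', two_mul, add_smul]
  abel

/-- The derivative of `f` along the line through `z` in the direction `w`. -/
theorem hasDerivAt_comp_line (hU : IsOpen U) {f : E → ℝ} (hf : ContDiffOn ℝ ∞ f U) (w : E) {r : ℝ}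
    (hr : z + r • w ∈ U) :
    HasDerivAt (fun s : ℝ => f (z + s • w)) (dirDeriv w f (z + r • w)) r := by
  have h1 : HasDerivAt (fun s : ℝ => z + s • w) w r := by
    simpa using ((hasDerivAt_id r).smul_const w).const_add z
  exact (differentiableAt_of_contDiffOn hU hr hf).hasFDerivAt.comp_hasDerivAt r h1

theorem eventually_line_mem (hU : IsOpen U) (hz : z ∈ U) (w : E) :
    ∀ᶠ r : ℝ in nhds 0, z + r • w ∈ U := by
  have : ContinuousAt (fun r : ℝ => z + r • w) 0 := by fun_prop
  exact this.eventually_mem (hU.mem_nhds (by simpa using hz))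

/-- The necessary second order condition at a minimum. -/
theorem dirDeriv_dirDeriv_nonneg (hU : IsOpen U) (hz : z ∈ U) {f : E → ℝ}
    (hf : ContDiffOn ℝ ∞ f U) (w : E) (hmin : ∀ᶠ r : ℝ in nhds 0, f z ≤ f (z + r • w)) :
    0 ≤ dirDeriv w (dirDeriv w f) z := by
  have hz0 : z + (0 : ℝ) • w ∈ U := by simpa using hz
  set φ : ℝ → ℝ := fun s => f (z + s • w) with hφ
  have hφ0 : IsLocalMin φ 0 := by
    filter_upwards [hmin] with r hr
    simpa [hφ] using hr
  have hev : deriv φ =ᶠ[nhds 0] fun s => dirDeriv w f (z + s • w) := by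
    filter_upwards [eventually_line_mem hU hz w] with r hr
    exact (hasDerivAt_comp_line hU hf w hr).deriv
  have hd2 : deriv (deriv φ) 0 = dirDeriv w (dirDeriv w f) z := by
    rw [hev.deriv_eq, (hasDerivAt_comp_line hU (dirDeriv_contDiffOn hU hf w) w hz0).deriv]
    simp
  by_contra! hneg
  -- A negative second derivative would make the minimum also a local maximum, so `φ` would be
  -- locally constant with second derivative zero.
  have hmax : IsLocalMax φ 0 := isLocalMax_of_deriv_deriv_neg (by rw [hd2]; exact hneg)
    hφ0.deriv_eq_zero (hasDerivAt_comp_line hU hf w hz0).continuousAt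
  have hconst : φ =ᶠ[nhds 0] fun _ => φ 0 := by
    filter_upwards [hφ0, hmax] with r h1 h2
    exact le_antisymm h2 h1
  have : deriv φ =ᶠ[nhds 0] fun _ => 0 := by
    simpa using hconst.deriv
  rw [← hd2, this.deriv_eq] at hneg
  simp at hneg

/-- One-sided because the parabolic argument compares a point only with earlier times. -/
theorem HasDerivAt.nonpos_of_left_min {f : ℝ → ℝ} {d x : ℝ} (h : HasDerivAt f d x)
    (hmin : ∀ᶠ r in nhdsWithin x (Set.Iio x), f x ≤ f r) : d ≤ 0 := by
  have h' := h.hasDerivWithinAt (s := Set.Iio x)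
  rw [hasDerivWithinAt_iff_tendsto_slope' (by simp)] at h'
  refine le_of_tendsto h' ?_
  filter_upwards [hmin, self_mem_nhdsWithin] with r hr hr0
  have hr0 : r < x := hr0
  rw [slope_def_field]
  exact div_nonpos_of_nonneg_of_nonpos (by linarith) (by linarith)

theorem dirDeriv_nonpos (hU : IsOpen U) (hz : z ∈ U) {f : E → ℝ}
    (hf : ContDiffOn ℝ ∞ f U) (w : E)
    (hmin : ∀ᶠ r : ℝ in nhdsWithin 0 (Set.Iio 0), f z ≤ f (z + r • w)) :
    dirDeriv w f z ≤ 0 := by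
  have hz0 : z + (0 : ℝ) • w ∈ U := by simpa using hz
  have h := (hasDerivAt_comp_line hU hf w hz0).nonpos_of_left_min (by simpa using hmin)
  simpa using h

end DirDeriv
-- The flow in local coordinates: structure equations and evolution of `H`.
section CoordFlow

variable {n : ℕ}

/-- The `i`-th coordinate direction of `ℝⁿ × ℝ`. -/
def spaceDir (i : Fin n) : Euc n × ℝ := (EuclideanSpace.single i 1, 0)

/-- The time direction of `ℝⁿ × ℝ`. -/
def timeDir : Euc n × ℝ := (0, 1)

/-- A `Φ(H)`-flow in local coordinates, with the matrix `W` of its Weingarten map. -/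
structure CoordFlow (Φ : ℝ → ℝ) (U : Set (Euc n × ℝ)) (X ν : Euc n × ℝ → Euc (n + 1))
    (W : Fin n → Fin n → Euc n × ℝ → ℝ) : Prop where
  isOpen : IsOpen U
  smooth : ContDiffOn ℝ ∞ X U
  normal_smooth : ContDiffOn ℝ ∞ ν U
  weingarten_smooth : ∀ i j, ContDiffOn ℝ ∞ (W i j) U
  normal_unit : ∀ z ∈ U, ⟪ν z, ν z⟫_ℝ = 1
  normal_orthogonal : ∀ z ∈ U, ∀ i, ⟪ν z, dirDeriv (spaceDir i) X z⟫_ℝ = 0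
  weingarten : ∀ z ∈ U, ∀ j,
    dirDeriv (spaceDir j) ν z = ∑ k, W k j z • dirDeriv (spaceDir k) X z
  meanCurvature_pos : ∀ z ∈ U, 0 < ∑ j, W j j z
  evolution : ∀ z ∈ U, dirDeriv timeDir X z = -(Φ (∑ j, W j j z) • ν z)

/-- The coordinates at `z` are orthonormal, and their Christoffel symbols vanish at `z`. -/
structure IsNormalAt (X : Euc n × ℝ → Euc (n + 1)) (z : Euc n × ℝ) : Prop where
  orthonormal : ∀ i j,
    ⟪dirDeriv (spaceDir i) X z, dirDeriv (spaceDir j) X z⟫_ℝ = if i = j then 1 else 0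
  christoffel : ∀ i j k,
    ⟪dirDeriv (spaceDir i) (dirDeriv (spaceDir j) X) z, dirDeriv (spaceDir k) X z⟫_ℝ = 0

/-- Parseval's identity for an orthonormal frame of a hyperplane and its unit normal. -/
theorem inner_eq_sum_of_frame {e : Fin n → Euc (n + 1)} {N : Euc (n + 1)}
    (he : ∀ i j, ⟪e i, e j⟫_ℝ = if i = j then 1 else 0) (hN : ⟪N, N⟫_ℝ = 1)
    (hNe : ∀ i, ⟪N, e i⟫_ℝ = 0) (u v : Euc (n + 1)) :
    ⟪u, v⟫_ℝ = ∑ i, ⟪u, e i⟫_ℝ * ⟪v, e i⟫_ℝ + ⟪u, N⟫_ℝ * ⟪v, N⟫_ℝ := by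
  have ho : Orthonormal ℝ (Fin.snoc e N : Fin (n + 1) → Euc (n + 1)) := by
    rw [orthonormal_iff_ite]
    intro i j
    refine Fin.lastCases ?_ (fun i => ?_) i <;> refine Fin.lastCases ?_ (fun j => ?_) j
    · simpa using hN
    · simpa [Fin.ext_iff, j.2.ne'] using hNe j
    · simpa [Fin.ext_iff, i.2.ne, real_inner_comm] using hNe i
    · simpa [Fin.ext_iff] using he i j
  have hc : Fintype.card (Fin (n + 1)) = Module.finrank ℝ (Euc (n + 1)) := by simp
  let b := OrthonormalBasis.mk ho (by
    rw [ho.linearIndependent.span_eq_top_of_card_eq_finrank hc])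
  rw [← b.sum_inner_mul_inner u v, Fin.sum_univ_castSucc]
  simp [b, real_inner_comm v]

namespace CoordFlow

variable {Φ : ℝ → ℝ} {U : Set (Euc n × ℝ)} {X ν : Euc n × ℝ → Euc (n + 1)}
  {W : Fin n → Fin n → Euc n × ℝ → ℝ} {z : Euc n × ℝ}

local notation:max "∂" i:arg => dirDeriv (spaceDir i)
local notation:max "∂ₜ" => dirDeriv timeDir

theorem smooth_D (h : CoordFlow Φ U X ν W) (w) : ContDiffOn ℝ ∞ (dirDeriv w X) U :=
  dirDeriv_contDiffOn h.isOpen h.smooth w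

theorem smooth_DD (h : CoordFlow Φ U X ν W) (v w) :
    ContDiffOn ℝ ∞ (dirDeriv v (dirDeriv w X)) U :=
  dirDeriv_contDiffOn h.isOpen (h.smooth_D w) v

theorem normal_smooth_D (h : CoordFlow Φ U X ν W) (w) : ContDiffOn ℝ ∞ (dirDeriv w ν) U :=
  dirDeriv_contDiffOn h.isOpen h.normal_smooth w

theorem smooth_H (h : CoordFlow Φ U X ν W) : ContDiffOn ℝ ∞ (fun z => ∑ j, W j j z) U :=
  ContDiffOn.sum fun j _ => h.weingarten_smooth j j

theorem smooth_speed (h : CoordFlow Φ U X ν W) (hΦ : IsSpeed Φ) :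
    ContDiffOn ℝ ∞ (fun z => Φ (∑ j, W j j z)) U :=
  hΦ.smooth.comp h.smooth_H fun z hz => h.meanCurvature_pos z hz

theorem inner_normal_D (h : CoordFlow Φ U X ν W) (hz : z ∈ U) (w) :
    ⟪ν z, dirDeriv w ν z⟫_ℝ = 0 := by
  have := dirDeriv_congr h.isOpen hz h.normal_unit w
  rw [dirDeriv_inner h.isOpen hz h.normal_smooth h.normal_smooth, dirDeriv_const,
    real_inner_comm] at this
  linarith

theorem inner_normal_DD (h : CoordFlow Φ U X ν W) (hz : z ∈ U) (v w) :
    ⟪ν z, dirDeriv v (dirDeriv w ν) z⟫_ℝ = -⟪dirDeriv v ν z, dirDeriv w ν z⟫_ℝ := by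
  have := dirDeriv_congr h.isOpen hz (fun y hy => h.inner_normal_D hy w) v
  rw [dirDeriv_inner h.isOpen hz h.normal_smooth (h.normal_smooth_D w), dirDeriv_const] at this
  linarith

/-- Differentiate `⟪ν, ∂ j X⟫ = 0`. The direction `v` is arbitrary, so the same identity serves for
space (second fundamental form) and for time (evolution of `ν`). -/
theorem inner_DD (h : CoordFlow Φ U X ν W) (hz : z ∈ U) (v) (j) :
    ⟪dirDeriv v ν z, ∂ j X z⟫_ℝ = -⟪ν z, dirDeriv v (∂ j X) z⟫_ℝ := by
  have := dirDeriv_congr h.isOpen hz (fun y hy => h.normal_orthogonal y hy j) v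
  rw [dirDeriv_inner h.isOpen hz h.normal_smooth (h.smooth_D _), dirDeriv_const] at this
  linarith

theorem secondForm_comm (h : CoordFlow Φ U X ν W) (hz : z ∈ U) (i j) :
    ⟪∂ i ν z, ∂ j X z⟫_ℝ = ⟪∂ j ν z, ∂ i X z⟫_ℝ := by
  rw [h.inner_DD hz, h.inner_DD hz, dirDeriv_comm h.isOpen hz h.smooth]

/-- The tangential part of `∂ₜ ν` is the gradient of `Φ(H)`: commute `∂ₜ` with `∂ j` and insert the
flow equation. -/
theorem normal_evolution (h : CoordFlow Φ U X ν W) (hΦ : IsSpeed Φ) (hz : z ∈ U) (j) :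
    ⟪∂ₜ ν z, ∂ j X z⟫_ℝ = ∂ j (fun z => Φ (∑ j, W j j z)) z := by
  rw [h.inner_DD hz, dirDeriv_comm h.isOpen hz h.smooth,
    dirDeriv_congr h.isOpen hz h.evolution, dirDeriv_neg,
    dirDeriv_smul h.isOpen hz (h.smooth_speed hΦ) h.normal_smooth, inner_neg_right,
    inner_add_right, inner_smul_right, inner_smul_right, h.inner_normal_D hz, h.normal_unit z hz]
  ring

variable (hf : CoordFlow Φ U X ν W)
include hf

theorem weingarten_eq (hz : z ∈ U) (hN : IsNormalAt X z) (i j) :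
    W i j z = ⟪∂ j ν z, ∂ i X z⟫_ℝ := by
  rw [hf.weingarten z hz, sum_inner]
  simp [inner_smul_left, hN.orthonormal]

theorem parseval (hz : z ∈ U) (hN : IsNormalAt X z) (u v : Euc (n + 1)) :
    ⟪u, v⟫_ℝ = ∑ i, ⟪u, ∂ i X z⟫_ℝ * ⟪v, ∂ i X z⟫_ℝ + ⟪u, ν z⟫_ℝ * ⟪v, ν z⟫_ℝ :=
  inner_eq_sum_of_frame hN.orthonormal (hf.normal_unit z hz) (hf.normal_orthogonal z hz) u v

/-- With vanishing Christoffel symbols `∂ i (∂ j X)` has only a normal component, equal to minus the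
second fundamental form. -/
theorem inner_DDX (hz : z ∈ U) (hN : IsNormalAt X z) (u : Euc (n + 1)) (i j) :
    ⟪u, ∂ i (∂ j X) z⟫_ℝ = -(⟪u, ν z⟫_ℝ * ⟪∂ i ν z, ∂ j X z⟫_ℝ) := by
  rw [hf.parseval hz hN, hf.inner_DD hz, real_inner_comm _ (∂ i (∂ j X) z)]
  simp [hN.christoffel]

theorem inner_D_Dt_normal (hΦ : IsSpeed Φ) (hz : z ∈ U) (hN : IsNormalAt X z) (i j) :
    ⟪∂ i (∂ₜ ν) z, ∂ j X z⟫_ℝ = ∂ i (∂ j (fun z => Φ (∑ j, W j j z))) z := by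
  have := dirDeriv_congr hf.isOpen hz (fun y hy => hf.normal_evolution hΦ hy j) (spaceDir i)
  rw [dirDeriv_inner hf.isOpen hz (hf.normal_smooth_D _) (hf.smooth_D _),
    hf.inner_DDX hz hN, real_inner_comm (ν z), hf.inner_normal_D hz] at this
  linarith

/-- Differentiating `-Φ(H) ν` produces `∂ i Φ(H)` only along `ν`, and a tangential `u` does not see
it. -/
theorem D_Dt (hΦ : IsSpeed Φ) (hz : z ∈ U) (i) (u : Euc (n + 1)) (hu : ⟪ν z, u⟫_ℝ = 0) :
    ⟪∂ₜ (∂ i X) z, u⟫_ℝ = -(Φ (∑ j, W j j z) * ⟪∂ i ν z, u⟫_ℝ) := by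
  rw [dirDeriv_comm hf.isOpen hz hf.smooth, dirDeriv_congr hf.isOpen hz hf.evolution,
    dirDeriv_neg, dirDeriv_smul hf.isOpen hz (hf.smooth_speed hΦ) hf.normal_smooth,
    inner_neg_left, inner_add_left, inner_smul_left, inner_smul_left, hu]
  simp

/-- First derivatives of the mean curvature. -/
theorem D_meanCurvature (hz : z ∈ U) (hN : IsNormalAt X z) (a) :
    ∂ a (fun z => ∑ j, W j j z) z = ∑ j, ⟪∂ a (∂ j ν) z, ∂ j X z⟫_ℝ := by
  rw [dirDeriv_sum _ hf.isOpen hz (fun j => hf.weingarten_smooth j j)]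
  refine Finset.sum_congr rfl fun j _ => ?_
  have hsm : ∀ k, ContDiffOn ℝ ∞ (fun y => W k j y • ∂ k X y) U := fun k =>
    (hf.weingarten_smooth k j).smul (hf.smooth_D _)
  rw [dirDeriv_congr hf.isOpen hz (fun y hy => hf.weingarten y hy j),
    dirDeriv_sum _ hf.isOpen hz hsm, sum_inner]
  simp_rw [dirDeriv_smul hf.isOpen hz (hf.weingarten_smooth _ j) (hf.smooth_D _)]
  simp [inner_add_left, inner_smul_left, hN.orthonormal, hN.christoffel]

/-- Differentiate `∂ j ν = ∑ W k j ∂ k X` in time and pair with `∂ j X`. Working with the mixed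
tensor `W` avoids differentiating the inverse metric. -/
theorem Dt_meanCurvature (hΦ : IsSpeed Φ) (hz : z ∈ U) (hN : IsNormalAt X z) :
    ∂ₜ (fun z => ∑ j, W j j z) z =
      ∑ j, ∂ j (∂ j (fun z => Φ (∑ j, W j j z))) z +
        Φ (∑ j, W j j z) * ∑ j, ∑ k, W j k z * W k j z := by
  rw [dirDeriv_sum _ hf.isOpen hz (fun j => hf.weingarten_smooth j j), Finset.mul_sum,
    ← Finset.sum_add_distrib]
  refine Finset.sum_congr rfl fun j _ => ?_
  have hsm : ∀ k, ContDiffOn ℝ ∞ (fun y => W k j y • ∂ k X y) U := fun k =>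
    (hf.weingarten_smooth k j).smul (hf.smooth_D _)
  have h1 : ⟪∂ₜ (∂ j ν) z, ∂ j X z⟫_ℝ = ∂ₜ (W j j) z -
      Φ (∑ j, W j j z) * ∑ k, W j k z * W k j z := by
    rw [dirDeriv_congr hf.isOpen hz (fun y hy => hf.weingarten y hy j),
      dirDeriv_sum _ hf.isOpen hz hsm, sum_inner]
    simp_rw [dirDeriv_smul hf.isOpen hz (hf.weingarten_smooth _ j) (hf.smooth_D _)]
    simp only [inner_add_left, inner_smul_left, hN.orthonormal, Finset.sum_add_distrib,
      hf.D_Dt hΦ hz _ _ (hf.normal_orthogonal z hz j), ← hf.weingarten_eq hz hN]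
    simp only [RCLike.conj_to_real, mul_ite, mul_one, mul_zero, Finset.sum_ite_eq',
      Finset.mem_univ, if_true, sub_eq_add_neg, ← Finset.sum_neg_distrib, Finset.mul_sum]
    congr 1
    exact Finset.sum_congr rfl fun k _ => by ring
  rw [dirDeriv_comm hf.isOpen hz hf.normal_smooth, hf.inner_D_Dt_normal hΦ hz hN] at h1
  linarith

/-- Second derivatives of the mean curvature. -/
theorem DD_meanCurvature (hz : z ∈ U) (hN : IsNormalAt X z) (a) :
    ∂ a (∂ a (fun z => ∑ j, W j j z)) z =
      ∑ j, (⟪∂ a (∂ a (∂ j ν)) z, ∂ j X z⟫_ℝ - ⟪∂ j ν z, ∂ a (∂ a (∂ j X)) z⟫_ℝ) := by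
  have hsm : ∀ j k, ContDiffOn ℝ ∞ (fun y => W k j y • ∂ k X y) U := fun j k =>
    (hf.weingarten_smooth k j).smul (hf.smooth_D _)
  -- The cross terms contain `⟪∂ a (∂ k X), ∂ j X⟫`, which vanish in normal coordinates.
  have h1 : ∀ j, ⟪∂ a (∂ a (∂ j ν)) z, ∂ j X z⟫_ℝ = ∂ a (∂ a (W j j)) z +
      ∑ k, W k j z * ⟪∂ a (∂ a (∂ k X)) z, ∂ j X z⟫_ℝ := by
    intro j
    rw [dirDeriv_congr hf.isOpen hz (fun y hy => (dirDeriv_congr hf.isOpen hy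
        (fun y hy => hf.weingarten y hy j) _).trans (dirDeriv_sum _ hf.isOpen hy (hsm j) _)),
      dirDeriv_sum _ hf.isOpen hz (fun k => dirDeriv_contDiffOn hf.isOpen (hsm j k) _), sum_inner]
    simp_rw [dirDeriv_dirDeriv_smul hf.isOpen hz (hf.weingarten_smooth _ j) (hf.smooth_D _)]
    simp [inner_add_left, inner_smul_left, hN.orthonormal, hN.christoffel, Finset.sum_add_distrib]
  have h2 : ∑ j, ∑ k, W k j z * ⟪∂ a (∂ a (∂ k X)) z, ∂ j X z⟫_ℝ =
      ∑ j, ⟪∂ j ν z, ∂ a (∂ a (∂ j X)) z⟫_ℝ := by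
    rw [Finset.sum_comm]
    refine Finset.sum_congr rfl fun j _ => ?_
    rw [hf.weingarten z hz, sum_inner]
    refine Finset.sum_congr rfl fun k _ => ?_
    rw [inner_smul_left, real_inner_comm, hf.weingarten_eq hz hN, hf.weingarten_eq hz hN,
      hf.secondForm_comm hz]
    rfl
  rw [dirDeriv_congr hf.isOpen hz (fun y hy => dirDeriv_sum _ hf.isOpen hy
      (fun j => hf.weingarten_smooth j j) _),
    dirDeriv_sum _ hf.isOpen hz
      (fun j => dirDeriv_contDiffOn hf.isOpen (hf.weingarten_smooth j j) _),
    Finset.sum_sub_distrib, ← h2, ← Finset.sum_sub_distrib]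
  refine Finset.sum_congr rfl fun j _ => ?_
  rw [h1]; ring

end CoordFlow
end CoordFlow
-- Commuting higher derivatives; second derivative of a quadratic form along a moving vector.
section DirDeriv

variable {E F : Type*} [NormedAddCommGroup E] [NormedSpace ℝ E]
  [NormedAddCommGroup F] [InnerProductSpace ℝ F] {U : Set E} {z : E}

theorem dirDeriv_comm₃ (hU : IsOpen U) (hz : z ∈ U) {f : E → F} (hf : ContDiffOn ℝ ∞ f U)
    (v w : E) : dirDeriv v (dirDeriv w (dirDeriv w f)) z =
      dirDeriv w (dirDeriv w (dirDeriv v f)) z := by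
  rw [dirDeriv_comm hU hz (dirDeriv_contDiffOn hU hf w)]
  exact dirDeriv_congr hU hz (fun y hy => dirDeriv_comm hU hy hf v w) w

theorem dirDeriv_comm₄ (hU : IsOpen U) (hz : z ∈ U) {f : E → F} (hf : ContDiffOn ℝ ∞ f U)
    (v w : E) : dirDeriv v (dirDeriv v (dirDeriv w (dirDeriv w f))) z =
      dirDeriv w (dirDeriv w (dirDeriv v (dirDeriv v f))) z := by
  rw [dirDeriv_congr hU hz (fun y hy => dirDeriv_comm₃ hU hy hf v w) v]
  exact dirDeriv_comm₃ hU hz (dirDeriv_contDiffOn hU hf v) v w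

/-- The function differentiated is a quadratic form with entries `f₀, f₁, f₂` evaluated at `e_a + l
e_k`. As `l` vanishes at `z` with constant slope `m` along `w`, only these three terms survive. -/
theorem dirDeriv_dirDeriv_quadratic (hU : IsOpen U) (hz : z ∈ U) {l f₀ f₁ f₂ : E → ℝ}
    (hl : ContDiffOn ℝ ∞ l U) (h₀ : ContDiffOn ℝ ∞ f₀ U) (h₁ : ContDiffOn ℝ ∞ f₁ U)
    (h₂ : ContDiffOn ℝ ∞ f₂ U) {w : E} {m : ℝ} (hlz : l z = 0) (hlw : ∀ y ∈ U, dirDeriv w l y = m) :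
    dirDeriv w (dirDeriv w (fun y => f₀ y + (2 * (l y * f₁ y) + l y * (l y * f₂ y)))) z =
      dirDeriv w (dirDeriv w f₀) z + 4 * m * dirDeriv w f₁ z + 2 * m ^ 2 * f₂ z := by
  have h1 : ∀ y ∈ U, dirDeriv w (fun y => f₀ y + (2 * (l y * f₁ y) + l y * (l y * f₂ y))) y =
      dirDeriv w f₀ y + (2 * (m * f₁ y + l y * dirDeriv w f₁ y) +
        (m * (l y * f₂ y) + l y * (m * f₂ y + l y * dirDeriv w f₂ y))) := by
    intro y hy
    rw [dirDeriv_add hU hy h₀ ((contDiffOn_const.mul (hl.mul h₁)).add (hl.mul (hl.mul h₂))),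
      dirDeriv_add hU hy (contDiffOn_const.mul (hl.mul h₁)) (hl.mul (hl.mul h₂)),
      dirDeriv_const_mul hU hy _ (hl.mul h₁), dirDeriv_mul hU hy hl h₁,
      dirDeriv_mul hU hy hl (hl.mul h₂), dirDeriv_mul hU hy hl h₂, hlw y hy]
  have d₁ := dirDeriv_contDiffOn hU h₁ w
  have d₂ := dirDeriv_contDiffOn hU h₂ w
  have s1 : ContDiffOn ℝ ∞ (fun y => m * f₁ y + l y * dirDeriv w f₁ y) U :=
    (contDiffOn_const.mul h₁).add (hl.mul d₁)
  have s2 : ContDiffOn ℝ ∞ (fun y => m * f₂ y + l y * dirDeriv w f₂ y) U :=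
    (contDiffOn_const.mul h₂).add (hl.mul d₂)
  have s3 : ContDiffOn ℝ ∞ (fun y => m * (l y * f₂ y)) U := contDiffOn_const.mul (hl.mul h₂)
  rw [dirDeriv_congr hU hz h1, dirDeriv_add hU hz (dirDeriv_contDiffOn hU h₀ w)
      ((contDiffOn_const.mul s1).add (s3.add (hl.mul s2))),
    dirDeriv_add hU hz (contDiffOn_const.mul s1) (s3.add (hl.mul s2)),
    dirDeriv_const_mul hU hz _ s1, dirDeriv_add hU hz (contDiffOn_const.mul h₁) (hl.mul d₁),
    dirDeriv_const_mul hU hz _ h₁, dirDeriv_mul hU hz hl d₁, dirDeriv_add hU hz s3 (hl.mul s2),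
    dirDeriv_const_mul hU hz _ (hl.mul h₂), dirDeriv_mul hU hz hl h₂, dirDeriv_mul hU hz hl s2,
    hlz, hlw z hz]
  ring

end DirDeriv

/-! ### Simons' identity, the Codazzi equation and the tensor maximum principle. -/

namespace CoordFlow

variable {n : ℕ} {Φ : ℝ → ℝ} {U : Set (Euc n × ℝ)} {X ν : Euc n × ℝ → Euc (n + 1)}
  {W : Fin n → Fin n → Euc n × ℝ → ℝ} {z : Euc n × ℝ}

local notation:max "∂" i:arg => dirDeriv (spaceDir i)
local notation:max "∂ₜ" => dirDeriv timeDir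

variable (hf : CoordFlow Φ U X ν W)
include hf

theorem inner_DX_DDX (hz : z ∈ U) (hN : IsNormalAt X z) (i j k) :
    ⟪∂ i ν z, ∂ j (∂ k X) z⟫_ℝ = 0 := by
  rw [hf.inner_DDX hz hN, real_inner_comm, hf.inner_normal_D hz]
  simp

theorem D_secondForm (hz : z ∈ U) (hN : IsNormalAt X z) (i j k) :
    ∂ i (fun y => ⟪∂ j ν y, ∂ k X y⟫_ℝ) z = -⟪ν z, ∂ i (∂ j (∂ k X)) z⟫_ℝ := by
  rw [dirDeriv_congr hf.isOpen hz (fun y hy => hf.inner_DD hy (spaceDir j) k), dirDeriv_neg,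
    dirDeriv_inner hf.isOpen hz hf.normal_smooth (hf.smooth_DD _ _), hf.inner_DX_DDX hz hN,
    zero_add]

theorem inner_DDnormal_DX (hz : z ∈ U) (hN : IsNormalAt X z) (i j k) :
    ⟪∂ i (∂ j ν) z, ∂ k X z⟫_ℝ = -⟪ν z, ∂ i (∂ j (∂ k X)) z⟫_ℝ := by
  have := hf.D_secondForm hz hN i j k
  rw [dirDeriv_inner hf.isOpen hz (hf.normal_smooth_D _) (hf.smooth_D _),
    hf.inner_DX_DDX hz hN, add_zero] at this
  exact this

/-- Writing the second fundamental form as `-⟪ν, ∂ j (∂ k X)⟫` moves the highest derivatives onto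
`X`, where they commute. -/
theorem DD_secondForm (hz : z ∈ U) (i j k) :
    ∂ i (∂ i (fun y => ⟪∂ j ν y, ∂ k X y⟫_ℝ)) z =
      -(⟪∂ i (∂ i ν) z, ∂ j (∂ k X) z⟫_ℝ + 2 * ⟪∂ i ν z, ∂ i (∂ j (∂ k X)) z⟫_ℝ +
        ⟪ν z, ∂ i (∂ i (∂ j (∂ k X))) z⟫_ℝ) := by
  rw [← dirDeriv_dirDeriv_inner hf.isOpen hz hf.normal_smooth (hf.smooth_DD _ _), ← dirDeriv_neg]
  refine dirDeriv_congr hf.isOpen hz (fun y hy => ?_) _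
  rw [dirDeriv_congr hf.isOpen hy (fun y hy => hf.inner_DD hy (spaceDir j) k), dirDeriv_neg]

/-- The traced second derivatives of the second fundamental form (Simons' identity), in a
principal direction. -/
theorem simons (hz : z ∈ U) (hN : IsNormalAt X z) {a : Fin n} {c : ℝ}
    (ha : ∂ a ν z = c • ∂ a X z) :
    ∂ a (∂ a (fun z => ∑ j, W j j z)) z = ∑ j,
      (∂ j (∂ j (fun y => ⟪∂ a ν y, ∂ a X y⟫_ℝ - c * ⟪∂ a X y, ∂ a X y⟫_ℝ)) z +
        c * (⟪∂ j ν z, ∂ j ν z⟫_ℝ - c * ⟪∂ j ν z, ∂ j X z⟫_ℝ)) := by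
  rw [hf.DD_meanCurvature hz hN]
  refine Finset.sum_congr rfl fun j _ => ?_
  have hXa := hf.smooth_D (spaceDir a)
  have s1 : ContDiffOn ℝ ∞ (fun y => ⟪∂ a ν y, ∂ a X y⟫_ℝ) U :=
    (hf.normal_smooth_D _).inner ℝ hXa
  have s2 : ContDiffOn ℝ ∞ (fun y => ⟪∂ a X y, ∂ a X y⟫_ℝ) U := hXa.inner ℝ hXa
  have s3 : ContDiffOn ℝ ∞ (fun y => c * ⟪∂ a X y, ∂ a X y⟫_ℝ) U := contDiffOn_const.mul s2
  -- `e1` and `e2` expand `∂ a ∂ a h_jj` and `∂ j ∂ j Q_aa`. Their fourth order terms agree since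
  -- derivatives of `X` commute; their third order terms agree because `∂ a ν = c ∂ a X` at `z`.
  -- What remains are products of second derivatives, computed by `inner_DDX`.
  have e1 := hf.DD_secondForm hz a j j
  rw [dirDeriv_dirDeriv_inner hf.isOpen hz (hf.normal_smooth_D _) (hf.smooth_D _)] at e1
  have e2 : ∂ j (∂ j (fun y => ⟪∂ a ν y, ∂ a X y⟫_ℝ - c * ⟪∂ a X y, ∂ a X y⟫_ℝ)) z =
      ∂ j (∂ j (fun y => ⟪∂ a ν y, ∂ a X y⟫_ℝ)) z -
        c * ∂ j (∂ j (fun y => ⟪∂ a X y, ∂ a X y⟫_ℝ)) z := by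
    rw [← dirDeriv_const_mul hf.isOpen hz _ (dirDeriv_contDiffOn hf.isOpen s2 _),
      ← dirDeriv_sub hf.isOpen hz (dirDeriv_contDiffOn hf.isOpen s1 _)
        (contDiffOn_const.mul (dirDeriv_contDiffOn hf.isOpen s2 _))]
    refine dirDeriv_congr hf.isOpen hz (fun y hy => ?_) _
    rw [dirDeriv_sub hf.isOpen hy s1 s3, dirDeriv_const_mul hf.isOpen hy _ s2]
  rw [hf.DD_secondForm hz, dirDeriv_dirDeriv_inner hf.isOpen hz hXa hXa] at e2
  have hsym : ⟪∂ j ν z, ∂ a X z⟫_ℝ = c * ⟪∂ a X z, ∂ j X z⟫_ℝ := by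
    rw [hf.secondForm_comm hz, ha, inner_smul_left]; rfl
  have haj : ⟪∂ a ν z, ∂ j X z⟫_ℝ = c * ⟪∂ a X z, ∂ j X z⟫_ℝ := by
    rw [ha, inner_smul_left]; rfl
  have haν : ⟪∂ a ν z, ∂ j ν z⟫_ℝ = c * (c * ⟪∂ a X z, ∂ j X z⟫_ℝ) := by
    rw [ha, inner_smul_left, real_inner_comm, hsym]; rfl
  have haa : ⟪∂ a ν z, ∂ a ν z⟫_ℝ = c * (c * 1) := by
    rw [ha, inner_smul_left, inner_smul_right, hN.orthonormal]; simp
  have haX : ⟪∂ a ν z, ∂ a X z⟫_ℝ = c := by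
    rw [ha, inner_smul_left, hN.orthonormal]; simp
  have hl : ∀ u, ⟪∂ a ν z, u⟫_ℝ = c * ⟪∂ a X z, u⟫_ℝ := fun u => by
    rw [ha, inner_smul_left]; rfl
  have n1 : ⟪∂ a (∂ j ν) z, ν z⟫_ℝ = -⟪∂ a ν z, ∂ j ν z⟫_ℝ := by
    rw [real_inner_comm, hf.inner_normal_DD hz]
  have n2 : ⟪∂ a (∂ a ν) z, ν z⟫_ℝ = -⟪∂ a ν z, ∂ a ν z⟫_ℝ := by
    rw [real_inner_comm, hf.inner_normal_DD hz]
  have n3 : ⟪∂ j (∂ j ν) z, ν z⟫_ℝ = -⟪∂ j ν z, ∂ j ν z⟫_ℝ := by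
    rw [real_inner_comm, hf.inner_normal_DD hz]
  have n4 : ⟪∂ j (∂ a X) z, ν z⟫_ℝ = -⟪∂ j ν z, ∂ a X z⟫_ℝ := by
    rw [real_inner_comm, hf.inner_DD hz]; simp
  have k1 := hf.inner_DDX hz hN (∂ a (∂ j ν) z) a j
  have k2 := hf.inner_DDX hz hN (∂ a (∂ a ν) z) j j
  have k3 := hf.inner_DDX hz hN (∂ j (∂ j ν) z) a a
  have k4 := hf.inner_DDX hz hN (∂ j (∂ a X) z) j a
  rw [n1, haν, haj] at k1
  rw [n2, haa] at k2
  rw [n3, haX] at k3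
  rw [n4, hsym] at k4
  have c1 := dirDeriv_comm₃ hf.isOpen hz hf.smooth (spaceDir j) (spaceDir a)
  have c2 := dirDeriv_comm₃ hf.isOpen hz hf.smooth (spaceDir a) (spaceDir j)
  have c3 := dirDeriv_comm₄ hf.isOpen hz hf.smooth (spaceDir j) (spaceDir a)
  rw [e2, k3, k4, c1, c3, real_inner_comm (∂ a X z) (∂ j (∂ j (∂ a X)) z)]
  rw [k1, k2, hl, c2] at e1
  linarith

theorem D_metric (hz : z ∈ U) (hN : IsNormalAt X z) (i j k) :
    ∂ i (fun y => ⟪∂ j X y, ∂ k X y⟫_ℝ) z = 0 := by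
  rw [dirDeriv_inner hf.isOpen hz (hf.smooth_D _) (hf.smooth_D _), hN.christoffel,
    real_inner_comm, hN.christoffel, add_zero]

/-- The Codazzi equation. -/
theorem codazzi (hz : z ∈ U) (hN : IsNormalAt X z) (a : Fin n) (c : ℝ) :
    ∑ k, ∂ k (fun y => ⟪∂ k ν y, ∂ a X y⟫_ℝ - c * ⟪∂ k X y, ∂ a X y⟫_ℝ) z =
      ∂ a (fun z => ∑ j, W j j z) z := by
  rw [hf.D_meanCurvature hz hN]
  refine Finset.sum_congr rfl fun k _ => ?_
  have s2 : ContDiffOn ℝ ∞ (fun y => ⟪∂ k X y, ∂ a X y⟫_ℝ) U :=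
    (hf.smooth_D _).inner ℝ (hf.smooth_D _)
  rw [dirDeriv_sub hf.isOpen hz (f := fun y => ⟪∂ k ν y, ∂ a X y⟫_ℝ)
    (g := fun y => c * ⟪∂ k X y, ∂ a X y⟫_ℝ)
    ((hf.normal_smooth_D _).inner ℝ (hf.smooth_D _)) (contDiffOn_const.mul s2),
    dirDeriv_const_mul hf.isOpen hz _ s2, hf.D_metric hz hN, hf.D_secondForm hz hN,
    hf.inner_DDnormal_DX hz hN, dirDeriv_comm₃ hf.isOpen hz hf.smooth]
  ring

/-- The time derivative of `h - c g` in a null direction. -/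
theorem Dt_secondForm (hΦ : IsSpeed Φ) (hz : z ∈ U) (hN : IsNormalAt X z) {a : Fin n} {c : ℝ}
    (ha : ∂ a ν z = c • ∂ a X z) :
    ∂ₜ (fun y => ⟪∂ a ν y, ∂ a X y⟫_ℝ - c * ⟪∂ a X y, ∂ a X y⟫_ℝ) z =
      ∂ a (∂ a (fun z => Φ (∑ j, W j j z))) z + Φ (∑ j, W j j z) * c ^ 2 := by
  have hXa := hf.smooth_D (spaceDir a)
  have s1 : ContDiffOn ℝ ∞ (fun y => ⟪∂ a ν y, ∂ a X y⟫_ℝ) U :=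
    (hf.normal_smooth_D _).inner ℝ hXa
  have s2 : ContDiffOn ℝ ∞ (fun y => ⟪∂ a X y, ∂ a X y⟫_ℝ) U := hXa.inner ℝ hXa
  have hd := hf.D_Dt hΦ hz a _ (hf.normal_orthogonal z hz a)
  rw [dirDeriv_sub hf.isOpen hz s1 (contDiffOn_const.mul s2),
    dirDeriv_const_mul hf.isOpen hz _ s2, dirDeriv_inner hf.isOpen hz (hf.normal_smooth_D _) hXa,
    dirDeriv_inner hf.isOpen hz hXa hXa, dirDeriv_comm hf.isOpen hz hf.normal_smooth,
    hf.inner_D_Dt_normal hΦ hz hN, real_inner_comm (∂ₜ (∂ a X) z) (∂ a X z)]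
  have h2 : ⟪∂ a ν z, ∂ₜ (∂ a X) z⟫_ℝ = c * ⟪∂ₜ (∂ a X) z, ∂ a X z⟫_ℝ := by
    rw [ha, inner_smul_left, real_inner_comm]; rfl
  rw [h2, hd, ha, inner_smul_left, hN.orthonormal]
  simp
  ring

theorem DD_speed (hΦ : IsSpeed Φ) (hz : z ∈ U) (a : Fin n) :
    ∂ a (∂ a (fun z => Φ (∑ j, W j j z))) z =
      deriv Φ (∑ j, W j j z) * ∂ a (∂ a (fun z => ∑ j, W j j z)) z +
        deriv (deriv Φ) (∑ j, W j j z) * (∂ a (fun z => ∑ j, W j j z) z) ^ 2 := by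
  have hH := hf.smooth_H
  have hΦ' : ContDiffOn ℝ ∞ (deriv Φ) (Set.Ioi 0) := hΦ.smooth.deriv_of_isOpen isOpen_Ioi (by simp)
  have hchain : ∀ f : ℝ → ℝ, ContDiffOn ℝ ∞ f (Set.Ioi 0) → ∀ y ∈ U,
      ∂ a (fun z => f (∑ j, W j j z)) y = deriv f (∑ j, W j j y) * ∂ a (fun z => ∑ j, W j j z) y := by
    intro f hfs y hy
    have h1 := (differentiableAt_of_contDiffOn isOpen_Ioi (hf.meanCurvature_pos y hy) hfs).hasDerivAt
    have h2 := (differentiableAt_of_contDiffOn hf.isOpen hy hH).hasFDerivAt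
    have := h1.comp_hasFDerivAt y h2
    exact congrArg (fun l : (Euc n × ℝ) →L[ℝ] ℝ => l (spaceDir a)) this.fderiv
  have s1 : ContDiffOn ℝ ∞ (fun z => deriv Φ (∑ j, W j j z)) U :=
    hΦ'.comp hH fun z hz => hf.meanCurvature_pos z hz
  rw [dirDeriv_congr hf.isOpen hz (hchain Φ hΦ.smooth),
    dirDeriv_mul hf.isOpen hz s1 (dirDeriv_contDiffOn hf.isOpen hH _), hchain _ hΦ' z hz]
  ring

/-- The maximum principle for the lower bound of the second fundamental form: the form `h - c g`
cannot become degenerate at a positive time, as long as it is nonnegative before. -/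
theorem not_null (hΦ : IsSpeed Φ) (hz : z ∈ U) (hN : IsNormalAt X z) (a : Fin n) {c : ℝ}
    (hc : 0 < c)
    (hq : ∀ y ∈ U, y.2 ≤ z.2 → ∀ w : Euc n,
      c * ⟪dirDeriv (w, (0 : ℝ)) X y, dirDeriv (w, (0 : ℝ)) X y⟫_ℝ ≤
        ⟪dirDeriv (w, (0 : ℝ)) ν y, dirDeriv (w, (0 : ℝ)) X y⟫_ℝ) :
    ⟪∂ a ν z, ∂ a X z⟫_ℝ ≠ c * ⟪∂ a X z, ∂ a X z⟫_ℝ := by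
  intro h0
  set Q : Fin n → Fin n → Euc n × ℝ → ℝ :=
    fun i j y => ⟪∂ i ν y, ∂ j X y⟫_ℝ - c * ⟪∂ i X y, ∂ j X y⟫_ℝ with hQ
  have sQ : ∀ i j, ContDiffOn ℝ ∞ (Q i j) U := fun i j =>
    ((hf.normal_smooth_D _).inner ℝ (hf.smooth_D _)).sub
      (contDiffOn_const.mul ((hf.smooth_D _).inner ℝ (hf.smooth_D _)))
  have hdiag : ∀ y ∈ U, y.2 ≤ z.2 → ∀ k, 0 ≤ Q k k y := fun y hy hyz k =>
    sub_nonneg.2 (hq y hy hyz (EuclideanSpace.single k 1))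
  -- The form `Q` evaluated on the vector `e_a + s e_k`.
  have hpos : ∀ y ∈ U, y.2 ≤ z.2 → ∀ k (s : ℝ),
      0 ≤ Q a a y + (2 * (s * Q k a y) + s * (s * Q k k y)) := by
    intro y hy hyz k s
    have h1 := hq y hy hyz (EuclideanSpace.single a 1 + s • EuclideanSpace.single k 1)
    have hw : ((EuclideanSpace.single a 1 + s • EuclideanSpace.single k 1 : Euc n), (0 : ℝ)) =
        spaceDir a + s • spaceDir k := by
      simp [spaceDir]
    have hlin : ∀ f : Euc n × ℝ → Euc (n + 1), dirDeriv (spaceDir a + s • spaceDir k) f y =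
        ∂ a f y + s • ∂ k f y := fun f => by
      simp [dirDeriv]
    rw [hw, hlin, hlin] at h1
    simp only [inner_add_left, inner_add_right, inner_smul_left, inner_smul_right,
      RCLike.conj_to_real] at h1
    rw [hf.secondForm_comm hy a k, real_inner_comm (∂ k X y) (∂ a X y)] at h1
    simp only [hQ]
    linarith
  have hQaa : Q a a z = 0 := sub_eq_zero.2 h0
  have hQka : ∀ k, Q k a z = 0 := by
    intro k
    -- The quadratic in `s` is nonnegative with zero constant term, so its linear coefficient
    -- vanishes: a null vector of a semidefinite form lies in its kernel.
    have := discrim_le_zero (a := Q k k z) (b := 2 * Q k a z) (c := 0) fun s => by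
      have := hpos z hz le_rfl k s
      rw [hQaa] at this
      linarith
    rw [discrim] at this
    nlinarith
  have ha : ∂ a ν z = c • ∂ a X z := by
    rw [hf.weingarten z hz, Finset.sum_eq_single a]
    · rw [hf.weingarten_eq hz hN, h0, hN.orthonormal]; simp
    · intro k _ hk
      have := hQka k
      simp only [hQ, hN.orthonormal, if_neg hk] at this
      rw [hf.weingarten_eq hz hN, hf.secondForm_comm hz]
      simp only [mul_zero, sub_zero] at this
      rw [this, zero_smul]
    · simp
  set H := ∑ j, W j j z with hH
  have hH0 : 0 < H := hf.meanCurvature_pos z hz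
  set α := ∂ a (fun z => ∑ j, W j j z) z with hα
  -- Second order condition at `z` for `Q` on the field `e_a + m (x_k - z_k) e_k`. The slope `m =
  -- -(α / H)` minimizes `4mα + 2m²H`, the bound obtained after summing over `k`; the minimum is
  -- `-2α² / H`.
  have htest : ∀ k, 0 ≤ ∂ k (∂ k (Q a a)) z + 4 * (-(α / H)) * ∂ k (Q k a) z +
      2 * (-(α / H)) ^ 2 * Q k k z := by
    intro k
    let l : (Euc n × ℝ) →L[ℝ] ℝ :=
      (EuclideanSpace.proj k).comp (ContinuousLinearMap.fst ℝ (Euc n) ℝ)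
    have hl : ContDiffOn ℝ ∞ (fun y => -(α / H) * (l y - l z)) U := by fun_prop
    have hlw : ∀ y ∈ U, ∂ k (fun y => -(α / H) * (l y - l z)) y = -(α / H) := by
      intro y hy
      have hls : ContDiffOn ℝ ∞ (fun y => l y) U := by fun_prop
      rw [dirDeriv_const_mul hf.isOpen hy _ (hls.sub contDiffOn_const),
        dirDeriv_sub hf.isOpen hy hls contDiffOn_const, dirDeriv_const]
      change _ * (∂ k l y - 0) = _
      rw [dirDeriv_clm]
      simp [l, spaceDir]
    rw [← dirDeriv_dirDeriv_quadratic hf.isOpen hz hl (sQ a a) (sQ k a) (sQ k k) (by simp) hlw]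
    refine dirDeriv_dirDeriv_nonneg hf.isOpen hz ((sQ a a).add ((contDiffOn_const.mul
      (hl.mul (sQ k a))).add (hl.mul (hl.mul (sQ k k))))) _ ?_
    filter_upwards [eventually_line_mem hf.isOpen hz (spaceDir k)] with r hr
    refine le_trans (le_of_eq ?_) (hpos _ hr (by simp [spaceDir]) k _)
    simp [hQaa]
  have hsum := Finset.sum_nonneg fun k (_ : k ∈ Finset.univ) => htest k
  rw [Finset.sum_add_distrib, Finset.sum_add_distrib, ← Finset.mul_sum, ← Finset.mul_sum,
    hf.codazzi hz hN, ← hα] at hsum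
  have htr : ∑ k, Q k k z ≤ H := by
    refine Finset.sum_le_sum fun k _ => ?_
    simp only [hQ, hN.orthonormal, if_true, hf.weingarten_eq hz hN]
    linarith
  have hsi := hf.simons hz hN ha
  rw [Finset.sum_add_distrib] at hsi
  -- Cauchy–Schwarz gives `|∂ j ν|² ≥ h_jj²`, and `h_jj ≥ c > 0`.
  have hsq : 0 ≤ ∑ j, c * (⟪∂ j ν z, ∂ j ν z⟫_ℝ - c * ⟪∂ j ν z, ∂ j X z⟫_ℝ) := by
    refine Finset.sum_nonneg fun j _ => mul_nonneg hc.le ?_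
    have h1 := hdiag z hz le_rfl j
    have h2 := real_inner_mul_inner_self_le (∂ j ν z) (∂ j X z)
    simp only [hQ, hN.orthonormal, if_true] at h1 h2
    nlinarith
  have ht : ∂ₜ (Q a a) z ≤ 0 := by
    refine dirDeriv_nonpos hf.isOpen hz (sQ a a) _ ?_
    filter_upwards [(eventually_line_mem hf.isOpen hz timeDir).filter_mono nhdsWithin_le_nhds,
      self_mem_nhdsWithin] with r hr hr0
    rw [hQaa]
    refine hdiag _ hr ?_ a
    have hr0 : r < 0 := hr0
    simp [timeDir, hr0.le]
  rw [hf.Dt_secondForm hΦ hz hN ha, hf.DD_speed hΦ hz, ← hα, ← hH] at ht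
  have hΦ0 := hΦ.pos H hH0
  have hΦ1 := hΦ.deriv_pos H hH0
  have hΦ2 := hΦ.deriv2_ge H hH0
  have hD : 2 * α ^ 2 / H ≤ ∂ a (∂ a (fun z => ∑ j, W j j z)) z := by
    have h1 : 2 * (-(α / H)) ^ 2 * ∑ k, Q k k z ≤ 2 * (-(α / H)) ^ 2 * H := by gcongr
    have h2 : 2 * (-(α / H)) ^ 2 * H = 2 * α ^ 2 / H := by field_simp
    have h3 : 4 * (-(α / H)) * α = -(4 * α ^ 2 / H) := by ring
    rw [h3] at hsum
    have h4 : 4 * α ^ 2 / H = 2 * (2 * α ^ 2 / H) := by ring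
    linarith
  have h5 := mul_le_mul_of_nonneg_left hD hΦ1.le
  -- The gradient gain `Φ' · 2α²/H` exactly absorbs the worst case of `Φ'' α²`; the strictly
  -- positive `Φ(H) c²` is left and contradicts `ht`.
  have h6 := mul_le_mul_of_nonneg_right hΦ2 (sq_nonneg α)
  have h7 : -2 * deriv Φ H / H * α ^ 2 = -(deriv Φ H * (2 * α ^ 2 / H)) := by ring
  have h8 := mul_pos hΦ0 (pow_pos hc 2)
  linarith

/-- At a spatial maximum of the mean curvature, `∂H/∂t ≤ Φ(H)|A|²`. -/
theorem Dt_meanCurvature_le (hΦ : IsSpeed Φ) (hz : z ∈ U) (hN : IsNormalAt X z)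
    (hmax : ∀ y ∈ U, y.2 = z.2 → ∑ j, W j j y ≤ ∑ j, W j j z) :
    ∂ₜ (fun z => ∑ j, W j j z) z ≤ Φ (∑ j, W j j z) * ∑ j, ∑ k, W j k z * W k j z := by
  rw [hf.Dt_meanCurvature hΦ hz hN]
  have : ∀ j, ∂ j (∂ j (fun z => Φ (∑ j, W j j z))) z ≤ 0 := by
    intro j
    have h1 := dirDeriv_dirDeriv_nonneg hf.isOpen hz (f := fun z => -Φ (∑ j, W j j z))
      (hf.smooth_speed hΦ).neg (spaceDir j) (by
        filter_upwards [eventually_line_mem hf.isOpen hz (spaceDir j)] with r hr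
        exact neg_le_neg (hΦ.strictMonoOn.monotoneOn (hf.meanCurvature_pos _ hr)
          (hf.meanCurvature_pos z hz) (hmax _ hr (by simp [spaceDir]))))
    rw [dirDeriv_congr hf.isOpen hz (fun y _ => dirDeriv_neg _ _ _), dirDeriv_neg] at h1
    linarith
  have := Finset.sum_nonpos fun j (_ : j ∈ Finset.univ) => this j
  linarith

end CoordFlow
-- Spectral theorem for Weingarten maps, and traces.
section LinearAlgebra

variable {V F : Type*} [AddCommGroup V] [Module ℝ V] [FiniteDimensional ℝ V]
  [NormedAddCommGroup F] [InnerProductSpace ℝ F] {L N : V →ₗ[ℝ] F} {S : V →ₗ[ℝ] V}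

/-- A self-adjoint endomorphism, for the inner product induced by an injective map `L`, has an
orthonormal basis of eigenvectors. -/
theorem exists_eigenbasis_of_injective (hL : Function.Injective L) (hS : ∀ v, L (S v) = N v)
    (hsymm : ∀ v w, ⟪N v, L w⟫_ℝ = ⟪N w, L v⟫_ℝ) :
    ∃ (κ : Fin (Module.finrank ℝ V) → ℝ) (e : Module.Basis (Fin (Module.finrank ℝ V)) ℝ V),
      (∀ i, S (e i) = κ i • e i) ∧ ∀ i j, ⟪L (e i), L (e j)⟫_ℝ = if i = j then 1 else 0 := by
  -- `V` carries no inner product, so `S` is transported to the range of `L`, which inherits one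
  -- from `F`.
  let f : V ≃ₗ[ℝ] LinearMap.range L := LinearEquiv.ofInjective L hL
  have hf : ∀ v, ((f v : LinearMap.range L) : F) = L v := fun v => rfl
  let R : LinearMap.range L →ₗ[ℝ] LinearMap.range L := f.conj S
  have hR : R.IsSymmetric := by
    intro x y
    obtain ⟨v, rfl⟩ := f.surjective x
    obtain ⟨w, rfl⟩ := f.surjective y
    simp only [R, LinearEquiv.conj_apply_apply, LinearEquiv.symm_apply_apply,
      Submodule.coe_inner, hf, hS]
    rw [hsymm, real_inner_comm]
  have hd : Module.finrank ℝ (LinearMap.range L) = Module.finrank ℝ V := f.symm.finrank_eq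
  let b := hR.eigenvectorBasis hd
  refine ⟨hR.eigenvalues hd, b.toBasis.map f.symm, fun i => ?_, fun i j => ?_⟩
  · have h1 := hR.apply_eigenvectorBasis hd i
    rw [Module.Basis.map_apply, b.coe_toBasis]
    apply f.injective
    rw [map_smul, LinearEquiv.apply_symm_apply]
    exact h1
  · have := orthonormal_iff_ite.1 b.orthonormal i j
    simpa [← hf] using this

omit [FiniteDimensional ℝ V] in
theorem trace_eq_sum_of_eigenbasis {κ : Fin (Module.finrank ℝ V) → ℝ}
    (e : Module.Basis (Fin (Module.finrank ℝ V)) ℝ V) (he : ∀ i, S (e i) = κ i • e i) :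
    LinearMap.trace ℝ V S = ∑ i, κ i := by
  rw [LinearMap.trace_eq_matrix_trace ℝ e, Matrix.trace]
  refine Finset.sum_congr rfl fun i _ => ?_
  simp [LinearMap.toMatrix_apply, he]

theorem inner_pos_of_eigenvalues_pos (hL : Function.Injective L) (hS : ∀ v, L (S v) = N v)
    (hsymm : ∀ v w, ⟪N v, L w⟫_ℝ = ⟪N w, L v⟫_ℝ)
    (hpos : ∀ κ, Module.End.HasEigenvalue S κ → 0 < κ) {v : V} (hv : v ≠ 0) :
    0 < ⟪N v, L v⟫_ℝ := by
  obtain ⟨κ, e, he, ho⟩ := exists_eigenbasis_of_injective hL hS hsymm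
  have hκ : ∀ i, 0 < κ i := fun i => hpos _ (Module.End.hasEigenvalue_of_hasEigenvector
    ⟨Module.End.mem_eigenspace_iff.2 (he i), e.ne_zero i⟩)
  have h1 : ⟪N v, L v⟫_ℝ = ∑ i, κ i * (e.repr v i) ^ 2 := by
    rw [← hS]
    conv_lhs => rw [← e.sum_repr v]
    simp only [map_sum, map_smul, he, sum_inner, inner_sum, inner_smul_left, inner_smul_right, ho,
      RCLike.conj_to_real, mul_ite, mul_one, mul_zero, Finset.sum_ite_eq', Finset.mem_univ, if_true]
    exact Finset.sum_congr rfl fun i _ => by ring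
  rw [h1]
  obtain ⟨i, hi⟩ : ∃ i, e.repr v i ≠ 0 := by
    by_contra! h
    exact hv (e.repr.map_eq_zero_iff.1 (Finsupp.ext h))
  exact Finset.sum_pos' (fun i _ => mul_nonneg (hκ i).le (sq_nonneg _))
    ⟨i, Finset.mem_univ _, mul_pos (hκ i) (by positivity)⟩

/-- In an eigenbasis this is `∑ κ_i² ≤ (∑ κ_i)²` for `κ_i ≥ 0`; geometrically, `|A|² ≤ H²` for a
convex hypersurface. -/
theorem trace_comp_self_le (hL : Function.Injective L) (hS : ∀ v, L (S v) = N v)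
    (hsymm : ∀ v w, ⟪N v, L w⟫_ℝ = ⟪N w, L v⟫_ℝ) (hnn : ∀ v, 0 ≤ ⟪N v, L v⟫_ℝ) :
    LinearMap.trace ℝ V (S ∘ₗ S) ≤ LinearMap.trace ℝ V S ^ 2 := by
  obtain ⟨κ, e, he, ho⟩ := exists_eigenbasis_of_injective hL hS hsymm
  have hκ : ∀ i, 0 ≤ κ i := fun i => by
    have := hnn (e i)
    rwa [← hS, he, map_smul, inner_smul_left, ho, if_pos rfl, mul_one] at this
  rw [trace_eq_sum_of_eigenbasis e he, trace_eq_sum_of_eigenbasis (κ := fun i => κ i ^ 2) e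
    fun i => by simp [he, smul_smul, sq]]
  exact Finset.sum_sq_le_sq_sum_of_nonneg fun i _ => hκ i

omit [FiniteDimensional ℝ V] in
/-- The traces of an endomorphism and of its square, from its matrix in coordinates. -/
theorem trace_eq_of_conj {n : ℕ} (f : Euc n ≃ₗ[ℝ] V) (K : Euc n →ₗ[ℝ] Euc n)
    (hK : ∀ w, f (K w) = S (f w)) :
    LinearMap.trace ℝ V S = ∑ j, K (EuclideanSpace.single j 1) j ∧
    LinearMap.trace ℝ V (S ∘ₗ S) = ∑ j, ∑ k,
      K (EuclideanSpace.single k 1) j * K (EuclideanSpace.single j 1) k := by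
  have h1 : S = f.conj K := by
    ext v
    simp [LinearEquiv.conj_apply_apply, hK]
  have h2 : S ∘ₗ S = f.conj (K ∘ₗ K) := by
    rw [h1, LinearEquiv.conj_comp]
  have ht : ∀ K' : Euc n →ₗ[ℝ] Euc n, LinearMap.trace ℝ V (f.conj K') =
      ∑ j, K' (EuclideanSpace.single j 1) j := by
    intro K'
    rw [LinearMap.trace_conj', LinearMap.trace_eq_sum_inner K' (EuclideanSpace.basisFun _ ℝ)]
    simp [EuclideanSpace.inner_single_left]
  refine ⟨h1 ▸ ht K, ?_⟩
  rw [h2, ht]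
  refine Finset.sum_congr rfl fun j _ => ?_
  have hsum : K (EuclideanSpace.single j 1) =
      ∑ k, K (EuclideanSpace.single j 1) k • EuclideanSpace.single k (1 : ℝ) := by
    ext i; simp [Pi.single_apply]
  rw [LinearMap.comp_apply]
  conv_lhs => rw [hsum]
  simp only [map_sum, map_smul, WithLp.ofLp_sum, WithLp.ofLp_smul, Finset.sum_apply, Pi.smul_apply, smul_eq_mul]
  exact Finset.sum_congr rfl fun k _ => mul_comm _ _

end LinearAlgebra

/-! ### Tangent spaces and parametrizations. -/

section Hypersurface

variable {n : ℕ} {M : Type*} [TopologicalSpace M] [ChartedSpace (Euc n) M]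

instance tangentSpace_finiteDimensional (p : M) : FiniteDimensional ℝ (TangentSpace (𝓡 n) p) :=
  inferInstanceAs (FiniteDimensional ℝ (Euc n))

theorem finrank_tangentSpace (p : M) : Module.finrank ℝ (TangentSpace (𝓡 n) p) = n :=
  (finrank_euclideanSpace_fin : Module.finrank ℝ (Euc n) = n)

/-- The defining property of the Weingarten map. -/
theorem diffAt_weingarten {F ν : M → Euc (n + 1)} {p : M} (hF : Function.Injective (diffAt F p))
    (hν : ‖ν p‖ = 1) (ho : ∀ v, ⟪ν p, diffAt F p v⟫_ℝ = 0) (ho' : ∀ v, ⟪ν p, diffAt ν p v⟫_ℝ = 0)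
    (v : TangentSpace (𝓡 n) p) : diffAt F p (weingarten F ν p v) = diffAt ν p v := by
  have : Fact (Module.finrank ℝ (Euc (n + 1)) = n + 1) := ⟨by simp⟩
  -- Dimension count: an `n`-dimensional subspace contained in the hyperplane `ν^⊥`.
  have hrange : LinearMap.range (diffAt F p) = (ℝ ∙ ν p)ᗮ := by
    refine Submodule.eq_of_le_of_finrank_eq ?_ ?_
    · rintro _ ⟨w, rfl⟩
      exact Submodule.mem_orthogonal_singleton_iff_inner_right.2 (ho w)
    · rw [LinearMap.finrank_range_of_inj hF, finrank_tangentSpace,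
        Submodule.finrank_orthogonal_span_singleton (n := n)]
      intro h
      simp [h] at hν
  obtain ⟨w, hw⟩ : diffAt ν p v ∈ LinearMap.range (diffAt F p) := by
    rw [hrange]
    exact Submodule.mem_orthogonal_singleton_iff_inner_right.2 (ho' v)
  rw [weingarten, LinearMap.comp_apply, ← hw,
    LinearMap.leftInverse_apply_of_inj (LinearMap.ker_eq_bot.2 hF)]

/-- A smooth parametrization, by an open subset of `ℝⁿ`, of a part of the manifold `M`. -/
structure IsParametrization (P : Euc n → M) (V : Set (Euc n)) : Prop where
  isOpen : IsOpen V
  smooth : ContMDiffOn 𝓘(ℝ, Euc n) (𝓡 n) ∞ P V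
  immersion : ∀ y ∈ V, Function.Injective (mfderiv 𝓘(ℝ, Euc n) (𝓡 n) P y)

/-- The spatial differential of a time-dependent map in a parametrization. -/
def coordDiff (P : Euc n → M) (F : M → ℝ → Euc (n + 1)) (z : Euc n × ℝ) :
    Euc n →L[ℝ] Euc (n + 1) :=
  fderiv ℝ (fun y => F (P y) z.2) z.1

/-- The Weingarten map in a parametrization. -/
def coordWeingarten (P : Euc n → M) (X ν : M → ℝ → Euc (n + 1)) (z : Euc n × ℝ) :
    Euc n →L[ℝ] Euc n :=
  ((coordDiff P X z).adjoint ∘L coordDiff P X z).inverse ∘L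
    ((coordDiff P X z).adjoint ∘L coordDiff P ν z)

namespace IsParametrization

variable {P : Euc n → M} {V : Set (Euc n)} {T : ℝ}

/-- The differential of a parametrization, as a linear isomorphism. -/
def equiv (hP : IsParametrization P V) {y : Euc n} (hy : y ∈ V) :
    Euc n ≃ₗ[ℝ] TangentSpace (𝓡 n) (P y) :=
  LinearEquiv.ofInjectiveOfFinrankEq (mfderiv 𝓘(ℝ, Euc n) (𝓡 n) P y).toLinearMap
    (hP.immersion y hy) (by rw [finrank_tangentSpace]; exact finrank_euclideanSpace_fin)

theorem contDiffOn (hP : IsParametrization P V) {F : M → ℝ → Euc (n + 1)}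
    (hF : ContMDiffOn ((𝓡 n).prod 𝓘(ℝ, ℝ)) 𝓘(ℝ, Euc (n + 1)) ∞
      (fun q : M × ℝ => F q.1 q.2) (Set.univ ×ˢ Set.Ico 0 T)) :
    ContDiffOn ℝ ∞ (fun z : Euc n × ℝ => F (P z.1) z.2) (V ×ˢ Set.Ico 0 T) := by
  rw [← contMDiffOn_iff_contDiffOn]
  have h1 : ContMDiffOn 𝓘(ℝ, Euc n × ℝ) (𝓡 n) ∞ (fun z : Euc n × ℝ => P z.1)
      (V ×ˢ Set.Ico 0 T) :=
    hP.smooth.comp (contDiff_fst.contMDiff.contMDiffOn) fun z hz => hz.1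
  have h2 : ContMDiffOn 𝓘(ℝ, Euc n × ℝ) 𝓘(ℝ, ℝ) ∞ (fun z : Euc n × ℝ => z.2)
      (V ×ˢ Set.Ico 0 T) := contDiff_snd.contMDiff.contMDiffOn
  exact hF.comp (h1.prodMk h2) fun z hz => ⟨trivial, hz.2⟩

theorem contDiffOn_slice (hP : IsParametrization P V) {F : M → ℝ → Euc (n + 1)}
    (hF : ContMDiffOn ((𝓡 n).prod 𝓘(ℝ, ℝ)) 𝓘(ℝ, Euc (n + 1)) ∞
      (fun q : M × ℝ => F q.1 q.2) (Set.univ ×ˢ Set.Ico 0 T)) {t : ℝ} (ht : t ∈ Set.Ico 0 T) :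
    ContDiffOn ℝ ∞ (fun y : Euc n => F (P y) t) V :=
  (hP.contDiffOn hF).comp (f := fun y => (y, t)) (by fun_prop) fun y hy => ⟨hy, ht⟩

theorem contDiffOn_coordDiff (hP : IsParametrization P V) {F : M → ℝ → Euc (n + 1)}
    (hF : ContMDiffOn ((𝓡 n).prod 𝓘(ℝ, ℝ)) 𝓘(ℝ, Euc (n + 1)) ∞
      (fun q : M × ℝ => F q.1 q.2) (Set.univ ×ˢ Set.Ico 0 T)) :
    ContDiffOn ℝ ∞ (coordDiff P F) (V ×ˢ Set.Ico 0 T) := by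
  -- The time interval is half-open, so smoothness of the spatial derivative up to `t = 0` is
  -- obtained through `fderivWithin` on the open set `V`.
  have h1 : ContDiffOn ℝ ∞ (fun z : Euc n × ℝ => fderivWithin ℝ (fun y => F (P y) z.2) V z.1)
      (V ×ˢ Set.Ico 0 T) := by
    intro z hz
    refine ContDiffWithinAt.fderivWithin (n := ∞) (f := fun (z : Euc n × ℝ) y => F (P y) z.2)
      ?_ contDiffWithinAt_fst hP.isOpen.uniqueDiffOn (by simp) hz fun z hz => hz.1
    exact ((hP.contDiffOn hF).comp (f := fun q : (Euc n × ℝ) × Euc n => (q.2, q.1.2))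
      (by fun_prop) fun q hq => ⟨hq.2, hq.1.2⟩) (z, z.1) ⟨hz, hz.1⟩
  exact h1.congr fun z hz => (fderivWithin_of_isOpen hP.isOpen hz.1).symm

theorem coordDiff_apply (hP : IsParametrization P V) {F : M → ℝ → Euc (n + 1)} {z : Euc n × ℝ}
    (hF : MDifferentiableAt (𝓡 n) 𝓘(ℝ, Euc (n + 1)) (fun q => F q z.2) (P z.1)) (hz : z.1 ∈ V)
    (w : Euc n) :
    coordDiff P F z w = diffAt (fun q => F q z.2) (P z.1) (hP.equiv hz w) := by
  have h1 : MDifferentiableAt 𝓘(ℝ, Euc n) (𝓡 n) P z.1 :=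
    (hP.smooth.contMDiffAt (hP.isOpen.mem_nhds hz)).mdifferentiableAt (by simp)
  rw [coordDiff, ← mfderiv_eq_fderiv]
  exact congrArg (fun l => l w) (mfderiv_comp z.1 hF h1)

/-- The inverse of a chart is a parametrization. -/
theorem extChartAt_symm [IsManifold (𝓡 n) ∞ M] (p : M) :
    IsParametrization (extChartAt (𝓡 n) p).symm (extChartAt (𝓡 n) p).target where
  isOpen := isOpen_extChartAt_target p
  smooth := contMDiffOn_extChartAt_symm p
  immersion y hy := by
    have := isInvertible_mfderivWithin_extChartAt_symm hy
    rw [ModelWithCorners.range_eq_univ, mfderivWithin_univ] at this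
    exact this.injective

end IsParametrization

end Hypersurface
/-- `LᵀL` is invertible for an injective linear map `L`. -/
theorem isInvertible_adjoint_comp_self {k m : ℕ} {L : Euc k →L[ℝ] Euc m}
    (hL : Function.Injective L) : (L.adjoint ∘L L).IsInvertible := by
  have hinj : Function.Injective (L.adjoint ∘L L).toLinearMap := by
    rw [← LinearMap.ker_eq_bot, LinearMap.ker_eq_bot']
    intro w hw
    have h1 : ⟪(L.adjoint ∘L L) w, w⟫_ℝ = 0 := by
      rw [show (L.adjoint ∘L L) w = 0 from hw, inner_zero_left]
    rw [ContinuousLinearMap.comp_apply, ContinuousLinearMap.adjoint_inner_left,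
      inner_self_eq_zero] at h1
    exact hL (h1.trans (map_zero L).symm)
  exact ⟨(LinearEquiv.ofInjectiveEndo _ hinj).toContinuousLinearEquiv, by ext; rfl⟩

/-! ### The flow read in a parametrization. -/

section Flow

variable {n : ℕ} {M : Type*} [TopologicalSpace M] [ChartedSpace (Euc n) M] {Φ : ℝ → ℝ} {T : ℝ}
  {X ν : M → ℝ → Euc (n + 1)} {P : Euc n → M} {V : Set (Euc n)}

theorem contMDiff_slice {F : M → ℝ → Euc (n + 1)}
    (hF : ContMDiffOn ((𝓡 n).prod 𝓘(ℝ, ℝ)) 𝓘(ℝ, Euc (n + 1)) ∞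
      (fun q : M × ℝ => F q.1 q.2) (Set.univ ×ˢ Set.Ico 0 T)) {t : ℝ} (ht : t ∈ Set.Ico 0 T) :
    ContMDiff (𝓡 n) 𝓘(ℝ, Euc (n + 1)) ∞ (fun q => F q t) := by
  rw [← contMDiffOn_univ]
  have h1 : ContMDiffOn (𝓡 n) ((𝓡 n).prod 𝓘(ℝ, ℝ)) ∞ (fun q : M => (q, t)) Set.univ :=
    contMDiffOn_id.prodMk contMDiffOn_const
  exact hF.comp h1 fun q _ => ⟨trivial, ht⟩

namespace IsPhiFlow

theorem coordDiff_X (h : IsPhiFlow Φ T X ν) (hP : IsParametrization P V) {z : Euc n × ℝ}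
    (hz : z ∈ V ×ˢ Set.Ico 0 T) (w : Euc n) :
    coordDiff P X z w = diffAt (fun q => X q z.2) (P z.1) (hP.equiv hz.1 w) :=
  hP.coordDiff_apply ((contMDiff_slice h.smooth hz.2).mdifferentiableAt (by simp)) hz.1 w

theorem coordDiff_normal (h : IsPhiFlow Φ T X ν) (hP : IsParametrization P V) {z : Euc n × ℝ}
    (hz : z ∈ V ×ˢ Set.Ico 0 T) (w : Euc n) :
    coordDiff P ν z w = diffAt (fun q => ν q z.2) (P z.1) (hP.equiv hz.1 w) :=
  hP.coordDiff_apply ((contMDiff_slice h.normal_smooth hz.2).mdifferentiableAt (by simp)) hz.1 w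

theorem inner_coordDiff_X (h : IsPhiFlow Φ T X ν) (hP : IsParametrization P V) {z : Euc n × ℝ}
    (hz : z ∈ V ×ˢ Set.Ico 0 T) (w : Euc n) : ⟪ν (P z.1) z.2, coordDiff P X z w⟫_ℝ = 0 := by
  rw [h.coordDiff_X hP hz]
  exact h.normal_orthogonal _ hz.2 _ _

theorem inner_coordDiff_normal (h : IsPhiFlow Φ T X ν) (hP : IsParametrization P V)
    {z : Euc n × ℝ} (hz : z ∈ V ×ˢ Set.Ico 0 T) (w : Euc n) :
    ⟪ν (P z.1) z.2, coordDiff P ν z w⟫_ℝ = 0 := by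
  have hs := hP.contDiffOn_slice h.normal_smooth hz.2
  have h1 := dirDeriv_congr (f := fun y => ⟪ν (P y) z.2, ν (P y) z.2⟫_ℝ) (g := fun _ => (1 : ℝ))
    hP.isOpen hz.1
    (fun y _ => by rw [real_inner_self_eq_norm_sq, h.normal_unit _ hz.2, one_pow]) w
  rw [dirDeriv_inner hP.isOpen hz.1 hs hs, dirDeriv_const, real_inner_comm] at h1
  change ⟪ν (P z.1) z.2, dirDeriv w (fun y => ν (P y) z.2) z.1⟫_ℝ = 0
  linarith

/-- Symmetry of the second fundamental form on a fixed time slice. Unlike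
`CoordFlow.secondForm_comm` it covers `t = 0`, where the strict convexity is given. -/
theorem inner_coordDiff_comm (h : IsPhiFlow Φ T X ν) (hP : IsParametrization P V)
    {z : Euc n × ℝ} (hz : z ∈ V ×ˢ Set.Ico 0 T) (v w : Euc n) :
    ⟪coordDiff P ν z v, coordDiff P X z w⟫_ℝ = ⟪coordDiff P ν z w, coordDiff P X z v⟫_ℝ := by
  have hs := hP.contDiffOn_slice h.normal_smooth hz.2
  have hX := hP.contDiffOn_slice h.smooth hz.2
  have key : ∀ v w : Euc n, ⟪coordDiff P ν z v, coordDiff P X z w⟫_ℝ =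
      -⟪ν (P z.1) z.2, dirDeriv v (dirDeriv w (fun y => X (P y) z.2)) z.1⟫_ℝ := by
    intro v w
    have h1 := dirDeriv_congr (f := fun y => ⟪ν (P y) z.2, dirDeriv w (fun y => X (P y) z.2) y⟫_ℝ)
      (g := fun _ => (0 : ℝ)) hP.isOpen hz.1
      (fun y hy => h.inner_coordDiff_X hP (z := (y, z.2)) ⟨hy, hz.2⟩ w) v
    rw [dirDeriv_inner hP.isOpen hz.1 hs (dirDeriv_contDiffOn hP.isOpen hX w),
      dirDeriv_const] at h1
    exact eq_neg_of_add_eq_zero_left h1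
  rw [key, key, dirDeriv_comm hP.isOpen hz.1 hX]

theorem inner_diffAt_normal [IsManifold (𝓡 n) ∞ M] (h : IsPhiFlow Φ T X ν) {t : ℝ}
    (ht : t ∈ Set.Ico 0 T) (p : M) (v : TangentSpace (𝓡 n) p) :
    ⟪ν p t, diffAt (fun q => ν q t) p v⟫_ℝ = 0 := by
  have hP := IsParametrization.extChartAt_symm (n := n) p
  have hy := mem_extChartAt_target (I := 𝓡 n) p
  -- Stated at the image of `p` under the chart and its inverse, since that point equals `p` only
  -- propositionally and the tangent space depends on it.
  have key : ∀ v : TangentSpace (𝓡 n) ((extChartAt (𝓡 n) p).symm (extChartAt (𝓡 n) p p)),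
      ⟪ν ((extChartAt (𝓡 n) p).symm (extChartAt (𝓡 n) p p)) t, diffAt (fun q => ν q t) _ v⟫_ℝ =
        0 := by
    intro v
    obtain ⟨w, rfl⟩ := (hP.equiv hy).surjective v
    have := h.inner_coordDiff_normal hP (z := (_, t)) ⟨hy, ht⟩ w
    rwa [h.coordDiff_normal hP ⟨hy, ht⟩] at this
  rw [extChartAt_to_inv] at key
  exact key v

theorem inner_diffAt_comm [IsManifold (𝓡 n) ∞ M] (h : IsPhiFlow Φ T X ν) {t : ℝ}
    (ht : t ∈ Set.Ico 0 T) (p : M) (v w : TangentSpace (𝓡 n) p) :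
    ⟪diffAt (fun q => ν q t) p v, diffAt (fun q => X q t) p w⟫_ℝ =
      ⟪diffAt (fun q => ν q t) p w, diffAt (fun q => X q t) p v⟫_ℝ := by
  have hP := IsParametrization.extChartAt_symm (n := n) p
  have hy := mem_extChartAt_target (I := 𝓡 n) p
  have key : ∀ v w : TangentSpace (𝓡 n) ((extChartAt (𝓡 n) p).symm (extChartAt (𝓡 n) p p)),
      ⟪diffAt (fun q => ν q t) _ v, diffAt (fun q => X q t) _ w⟫_ℝ =
        ⟪diffAt (fun q => ν q t) _ w, diffAt (fun q => X q t) _ v⟫_ℝ := by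
    intro v w
    obtain ⟨v, rfl⟩ := (hP.equiv hy).surjective v
    obtain ⟨w, rfl⟩ := (hP.equiv hy).surjective w
    have := h.inner_coordDiff_comm hP (z := (_, t)) ⟨hy, ht⟩ v w
    rwa [h.coordDiff_normal hP ⟨hy, ht⟩, h.coordDiff_normal hP ⟨hy, ht⟩,
      h.coordDiff_X hP ⟨hy, ht⟩, h.coordDiff_X hP ⟨hy, ht⟩] at this
  rw [extChartAt_to_inv] at key
  exact key v w

theorem diffAt_weingarten [IsManifold (𝓡 n) ∞ M] (h : IsPhiFlow Φ T X ν) {t : ℝ}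
    (ht : t ∈ Set.Ico 0 T) (p : M) (v : TangentSpace (𝓡 n) p) :
    diffAt (fun q => X q t) p (weingarten (fun q => X q t) (fun q => ν q t) p v) =
      diffAt (fun q => ν q t) p v :=
  _root_.diffAt_weingarten (F := fun q => X q t) (ν := fun q => ν q t) (h.immersion t ht p) (h.normal_unit t ht p)
    (h.normal_orthogonal t ht p) (h.inner_diffAt_normal ht p) v

theorem coordDiff_injective (h : IsPhiFlow Φ T X ν) (hP : IsParametrization P V) {z : Euc n × ℝ}
    (hz : z ∈ V ×ˢ Set.Ico 0 T) : Function.Injective (coordDiff P X z) := by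
  intro v w hvw
  rw [h.coordDiff_X hP hz, h.coordDiff_X hP hz] at hvw
  exact (hP.equiv hz.1).injective (h.immersion _ hz.2 _ hvw)

variable [IsManifold (𝓡 n) ∞ M]

/-- With `L` the differential of `X` in the parametrization, `(LᵀL)⁻¹Lᵀ` is a left inverse of `L`,
and `dν` takes values in the range of `L`, where all left inverses agree. -/
theorem equiv_coordWeingarten (h : IsPhiFlow Φ T X ν) (hP : IsParametrization P V)
    {z : Euc n × ℝ} (hz : z ∈ V ×ˢ Set.Ico 0 T) (w : Euc n) :
    hP.equiv hz.1 (coordWeingarten P X ν z w) =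
      weingarten (fun q => X q z.2) (fun q => ν q z.2) (P z.1) (hP.equiv hz.1 w) := by
  set u := (hP.equiv hz.1).symm
    (weingarten (fun q => X q z.2) (fun q => ν q z.2) (P z.1) (hP.equiv hz.1 w)) with hu
  have h1 : coordDiff P ν z w = coordDiff P X z u := by
    rw [h.coordDiff_normal hP hz, h.coordDiff_X hP hz, hu, LinearEquiv.apply_symm_apply,
      h.diffAt_weingarten hz.2]
  have h2 : coordWeingarten P X ν z w = u := by
    have h3 := isInvertible_adjoint_comp_self (h.coordDiff_injective hP hz)
    have h4 := ContinuousLinearMap.ext_iff.1 h3.inverse_comp_self u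
    rw [coordWeingarten, ContinuousLinearMap.comp_apply, ContinuousLinearMap.comp_apply, h1]
    exact h4
  rw [h2, hu, LinearEquiv.apply_symm_apply]

theorem coordDiff_coordWeingarten (h : IsPhiFlow Φ T X ν) (hP : IsParametrization P V)
    {z : Euc n × ℝ} (hz : z ∈ V ×ˢ Set.Ico 0 T) (w : Euc n) :
    coordDiff P X z (coordWeingarten P X ν z w) = coordDiff P ν z w := by
  rw [h.coordDiff_X hP hz, h.equiv_coordWeingarten hP hz, h.diffAt_weingarten hz.2,
    h.coordDiff_normal hP hz]

-- The left inverse in `weingarten` is chosen pointwise and carries no regularity; the explicit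
-- `(LᵀL)⁻¹Lᵀ` depends smoothly on `L`.
omit [IsManifold (𝓡 n) ∞ M] in
theorem contDiffOn_coordWeingarten (h : IsPhiFlow Φ T X ν) (hP : IsParametrization P V) :
    ContDiffOn ℝ ∞ (coordWeingarten P X ν) (V ×ˢ Set.Ico 0 T) := by
  let adj : (Euc n →L[ℝ] Euc (n + 1)) →L[ℝ] (Euc (n + 1) →L[ℝ] Euc n) :=
    LinearMap.toContinuousLinearMap
      { toFun := fun A => A.adjoint
        map_add' := fun A B => map_add _ A B
        map_smul' := fun c A => by simp }
  have hX := hP.contDiffOn_coordDiff h.smooth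
  have hν := hP.contDiffOn_coordDiff h.normal_smooth
  have hadj : ContDiffOn ℝ ∞ (fun z => (coordDiff P X z).adjoint) (V ×ˢ Set.Ico 0 T) :=
    adj.contDiff.comp_contDiffOn hX
  refine ContDiffOn.clm_comp ?_ (hadj.clm_comp hν)
  intro z hz
  obtain ⟨e, he⟩ := isInvertible_adjoint_comp_self (h.coordDiff_injective hP hz)
  refine ContDiffAt.comp_contDiffWithinAt (g := ContinuousLinearMap.inverse) z ?_
    (hadj.clm_comp hX z hz)
  rw [← he]
  exact contDiffAt_map_inverse e

theorem meanCurvature_eq (h : IsPhiFlow Φ T X ν) (hP : IsParametrization P V)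
    {z : Euc n × ℝ} (hz : z ∈ V ×ˢ Set.Ico 0 T) :
    meanCurvature (fun q => X q z.2) (fun q => ν q z.2) (P z.1) =
      ∑ j, coordWeingarten P X ν z (EuclideanSpace.single j 1) j :=
  (trace_eq_of_conj (hP.equiv hz.1) (coordWeingarten P X ν z).toLinearMap
    (h.equiv_coordWeingarten hP hz)).1

theorem trace_weingarten_sq_eq (h : IsPhiFlow Φ T X ν) (hP : IsParametrization P V)
    {z : Euc n × ℝ} (hz : z ∈ V ×ˢ Set.Ico 0 T) :
    LinearMap.trace ℝ _ (weingarten (fun q => X q z.2) (fun q => ν q z.2) (P z.1) ∘ₗ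
        weingarten (fun q => X q z.2) (fun q => ν q z.2) (P z.1)) =
      ∑ j, ∑ k, coordWeingarten P X ν z (EuclideanSpace.single k 1) j *
        coordWeingarten P X ν z (EuclideanSpace.single j 1) k :=
  (trace_eq_of_conj (hP.equiv hz.1) (coordWeingarten P X ν z).toLinearMap
    (h.equiv_coordWeingarten hP hz)).2

omit [IsManifold (𝓡 n) ∞ M] in
theorem dirDeriv_eq_coordDiff (hP : IsParametrization P V) {F : M → ℝ → Euc (n + 1)}
    (hF : ContMDiffOn ((𝓡 n).prod 𝓘(ℝ, ℝ)) 𝓘(ℝ, Euc (n + 1)) ∞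
      (fun q : M × ℝ => F q.1 q.2) (Set.univ ×ˢ Set.Ico 0 T))
    {z : Euc n × ℝ} (hz : z ∈ V ×ˢ Set.Ioo 0 T) (w : Euc n) :
    dirDeriv (w, (0 : ℝ)) (fun z : Euc n × ℝ => F (P z.1) z.2) z = coordDiff P F z w := by
  have h1 := (differentiableAt_of_contDiffOn (hP.isOpen.prod isOpen_Ioo) hz
    ((hP.contDiffOn hF).mono (Set.prod_mono_right Set.Ioo_subset_Ico_self))).hasFDerivAt
  have h2 : HasFDerivAt (fun y : Euc n => (y, z.2)) (ContinuousLinearMap.inl ℝ (Euc n) ℝ) z.1 :=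
    hasFDerivAt_prodMk_left z.1 z.2
  have h3 := HasFDerivAt.comp (f := fun y : Euc n => (y, z.2)) z.1 h1 h2
  exact (congrArg (fun l : Euc n →L[ℝ] Euc (n + 1) => l w) h3.fderiv).symm

/-- A `Φ(H)`-flow in a parametrization. -/
theorem coordFlow (h : IsPhiFlow Φ T X ν) (hP : IsParametrization P V) :
    CoordFlow Φ (V ×ˢ Set.Ioo 0 T) (fun z => X (P z.1) z.2) (fun z => ν (P z.1) z.2)
      (fun i j z => coordWeingarten P X ν z (EuclideanSpace.single j 1) i) := by
  have hsub : V ×ˢ Set.Ioo 0 T ⊆ V ×ˢ Set.Ico 0 T := Set.prod_mono_right Set.Ioo_subset_Ico_self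
  have hdir : ∀ {F : M → ℝ → Euc (n + 1)}
      (_ : ContMDiffOn ((𝓡 n).prod 𝓘(ℝ, ℝ)) 𝓘(ℝ, Euc (n + 1)) ∞
      (fun q : M × ℝ => F q.1 q.2) (Set.univ ×ˢ Set.Ico 0 T))
      {z : Euc n × ℝ} (_ : z ∈ V ×ˢ Set.Ioo 0 T) (i : Fin n),
      dirDeriv (spaceDir i) (fun z : Euc n × ℝ => F (P z.1) z.2) z =
        coordDiff P F z (EuclideanSpace.single i 1) := fun hF z hz i =>
    dirDeriv_eq_coordDiff hP hF hz _
  refine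
    { isOpen := hP.isOpen.prod isOpen_Ioo
      smooth := (hP.contDiffOn h.smooth).mono hsub
      normal_smooth := (hP.contDiffOn h.normal_smooth).mono hsub
      weingarten_smooth := fun i j => ?_
      normal_unit := fun z hz => ?_
      normal_orthogonal := fun z hz i => ?_
      weingarten := fun z hz j => ?_
      meanCurvature_pos := fun z hz => ?_
      evolution := fun z hz => ?_ }
  · exact (EuclideanSpace.proj i : Euc n →L[ℝ] ℝ).contDiff.comp_contDiffOn
      (((h.contDiffOn_coordWeingarten hP).mono hsub).clm_apply contDiffOn_const)
  · rw [real_inner_self_eq_norm_sq, h.normal_unit _ (hsub hz).2, one_pow]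
  · rw [hdir h.smooth hz]
    exact h.inner_coordDiff_X hP (hsub hz) _
  · rw [hdir h.normal_smooth hz, ← h.coordDiff_coordWeingarten hP (hsub hz)]
    simp_rw [hdir h.smooth hz, ← map_smul, ← map_sum]
    congr 1
    ext i
    simp [Pi.single_apply]
  · rw [← h.meanCurvature_eq hP (hsub hz)]
    exact h.meanCurvature_pos _ (hsub hz).2 _
  · rw [← h.meanCurvature_eq hP (hsub hz)]
    have h1 := (differentiableAt_of_contDiffOn (hP.isOpen.prod isOpen_Ioo) hz
      ((hP.contDiffOn h.smooth).mono hsub)).hasFDerivAt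
    have h2 : HasDerivAt (fun s : ℝ => (z.1, s)) ((0 : Euc n), (1 : ℝ)) z.2 :=
      (hasDerivAt_const z.2 z.1).prodMk (hasDerivAt_id z.2)
    have h3 := HasFDerivAt.comp_hasDerivAt (f := fun s : ℝ => (z.1, s)) z.2 h1 h2
    have h4 := (h.evolution _ (hsub hz).2 (P z.1)).hasDerivAt (Ico_mem_nhds hz.2.1 hz.2.2)
    exact h3.unique h4

end IsPhiFlow
end Flow
-- Normal coordinates from a graph over the tangent plane.
section Flow

variable {n : ℕ} {M : Type*} [TopologicalSpace M] [ChartedSpace (Euc n) M]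
  [IsManifold (𝓡 n) ∞ M] {Φ : ℝ → ℝ} {T : ℝ} {X ν : M → ℝ → Euc (n + 1)}

namespace IsPhiFlow

/-- The parametrization of a hypersurface of the flow as a graph over its tangent plane. -/
theorem exists_graph_parametrization (h : IsPhiFlow Φ T X ν) {t : ℝ} (ht : t ∈ Set.Ico 0 T) (p : M)
    {b : Fin n → Euc (n + 1)} (hb : ∀ i j, ⟪b i, b j⟫_ℝ = if i = j then 1 else 0)
    (hbr : ∀ i, ∃ v, diffAt (fun q => X q t) p v = b i) :
    ∃ (P : Euc n → M) (V : Set (Euc n)), IsParametrization P V ∧ (0 : Euc n) ∈ V ∧ P 0 = p ∧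
      ∀ y ∈ V, ∀ k, ⟪X (P y) t - X p t, b k⟫_ℝ = y k := by
  set Q : Euc n → M := fun x => (extChartAt (𝓡 n) p).symm x with hQ
  set V₀ := (extChartAt (𝓡 n) p).target with hV₀
  have hQP : IsParametrization Q V₀ := IsParametrization.extChartAt_symm p
  set x₀ := extChartAt (𝓡 n) p p with hx₀
  have hx : x₀ ∈ V₀ := mem_extChartAt_target p
  have hQx : Q x₀ = p := extChartAt_to_inv p
  have hXs := hQP.contDiffOn_slice h.smooth ht
  -- Coordinates of the orthogonal projection onto the tangent plane; the graph parametrization is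
  -- the local inverse of `f = π ∘ (X - X p) ∘ Q`.
  let π : Euc (n + 1) →L[ℝ] Euc n := (EuclideanSpace.equiv (Fin n) ℝ).symm.toContinuousLinearMap ∘L
    ContinuousLinearMap.pi fun k => innerSL ℝ (b k)
  have hπ : ∀ u k, π u k = ⟪u, b k⟫_ℝ := fun u k => by simp [π, real_inner_comm]
  let f : Euc n → Euc n := fun x => π (X (Q x) t - X p t)
  have hf : ContDiffOn ℝ ∞ f V₀ := π.contDiff.comp_contDiffOn (hXs.sub contDiffOn_const)
  have hfd : ∀ x ∈ V₀, HasFDerivAt f (π ∘L coordDiff Q X (x, t)) x := by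
    intro x hx
    have h1 := (differentiableAt_of_contDiffOn hQP.isOpen hx hXs).hasFDerivAt
    exact π.hasFDerivAt.comp x (h1.sub_const (X p t))
  have hcont : ContinuousOn (fun x => π ∘L coordDiff Q X (x, t)) V₀ := by
    have h1 : ContinuousOn (coordDiff Q X) (V₀ ×ˢ Set.Ico 0 T) :=
      (hQP.contDiffOn_coordDiff h.smooth).continuousOn
    have h2 : ContinuousOn (fun x => coordDiff Q X (x, t)) V₀ :=
      h1.comp (f := fun x => (x, t)) (by fun_prop) fun x hx => ⟨hx, ht⟩
    exact continuousOn_const.clm_comp h2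
  -- The inverse must be smooth on a whole neighbourhood, so the domain is cut down to the open set
  -- where the derivative of `f` is invertible.
  set V₁ := V₀ ∩ (fun x => π ∘L coordDiff Q X (x, t)) ⁻¹'
    Set.range ((↑) : (Euc n ≃L[ℝ] Euc n) → (Euc n →L[ℝ] Euc n)) with hV₁
  have hV₁o : IsOpen V₁ := hcont.isOpen_inter_preimage hQP.isOpen ContinuousLinearEquiv.isOpen
  have hinj : Function.Injective (π ∘L coordDiff Q X (x₀, t)).toLinearMap := by
    rw [← LinearMap.ker_eq_bot, LinearMap.ker_eq_bot']
    intro w hw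
    have hw : π (coordDiff Q X (x₀, t) w) = 0 := hw
    have hr : ⟪ν p t, coordDiff Q X (x₀, t) w⟫_ℝ = 0 := by
      have := h.inner_coordDiff_X hQP (z := (x₀, t)) ⟨hx, ht⟩ w
      rwa [hQx] at this
    have hN : ⟪ν p t, ν p t⟫_ℝ = 1 := by
      rw [real_inner_self_eq_norm_sq, h.normal_unit t ht, one_pow]
    have hNb : ∀ i, ⟪ν p t, b i⟫_ℝ = 0 := fun i => by
      obtain ⟨v, hv⟩ := hbr i
      rw [← hv]
      exact h.normal_orthogonal t ht p v
    have h0 : ⟪coordDiff Q X (x₀, t) w, coordDiff Q X (x₀, t) w⟫_ℝ = 0 := by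
      rw [inner_eq_sum_of_frame hb hN hNb, real_inner_comm (ν p t), hr]
      simp [← hπ, hw]
    rw [inner_self_eq_zero] at h0
    exact h.coordDiff_injective hQP (z := (x₀, t)) ⟨hx, ht⟩ (h0.trans (map_zero _).symm)
  have hx₁ : x₀ ∈ V₁ :=
    ⟨hx, (LinearEquiv.ofInjectiveEndo _ hinj).toContinuousLinearEquiv, by ext; rfl⟩
  obtain ⟨e₀, he₀⟩ := hx₁.2
  have hfx : ContDiffAt ℝ ∞ f x₀ := hf.contDiffAt (hQP.isOpen.mem_nhds hx)
  have hfx' : HasFDerivAt f (e₀ : Euc n →L[ℝ] Euc n) x₀ := by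
    rw [he₀]; exact hfd x₀ hx
  let g := hfx.toOpenPartialHomeomorph f hfx' (by simp)
  have hgf : ∀ x, g x = f x := fun x => rfl
  have hgx : x₀ ∈ g.source := hfx.mem_toOpenPartialHomeomorph_source hfx' (by simp)
  have hfx0 : f x₀ = 0 := by simp [f, hQx]
  have hg0 : g.symm 0 = x₀ := by
    rw [← hfx0, ← hgf, g.left_inv hgx]
  set V := g.target ∩ g.symm ⁻¹' V₁ with hV
  have h0V : (0 : Euc n) ∈ V := by
    refine ⟨?_, ?_⟩
    · rw [← hfx0, ← hgf]; exact g.map_source hgx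
    · rw [Set.mem_preimage, hg0]; exact hx₁
  have hVo : IsOpen V := g.isOpen_inter_preimage_symm hV₁o
  have hgs : ContDiffOn ℝ ∞ g.symm V := by
    intro y hy
    obtain ⟨e, he⟩ := hy.2.2
    refine (g.contDiffAt_symm hy.1 (f₀' := e) ?_ ?_).contDiffWithinAt
    · rw [he]; exact hfd _ hy.2.1
    · exact hf.contDiffAt (hQP.isOpen.mem_nhds hy.2.1)
  have hPs : ContMDiffOn 𝓘(ℝ, Euc n) (𝓡 n) ∞ (fun y => Q (g.symm y)) V :=
    hQP.smooth.comp hgs.contMDiffOn fun y hy => hy.2.1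
  have hgraph : ∀ y ∈ V, ∀ k, ⟪X (Q (g.symm y)) t - X p t, b k⟫_ℝ = y k := by
    intro y hy k
    rw [← hπ]
    exact congrArg (fun u : Euc n => u k) (g.right_inv hy.1)
  refine ⟨fun y => Q (g.symm y), V, ⟨hVo, hPs, fun y hy => ?_⟩, h0V, by simp only [hg0, hQx], hgraph⟩
  have hPd : MDifferentiableAt 𝓘(ℝ, Euc n) (𝓡 n) (fun y => Q (g.symm y)) y :=
    (hPs.contMDiffAt (hVo.mem_nhds hy)).mdifferentiableAt (by simp)
  have hXd : MDifferentiableAt (𝓡 n) 𝓘(ℝ, Euc n) (fun q => π (X q t - X p t)) (Q (g.symm y)) := by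
    have h1 := contMDiff_slice h.smooth ht
    have h2 : ContMDiff (𝓡 n) 𝓘(ℝ, Euc n) ∞ (fun q => π (X q t - X p t)) :=
      (π.contDiff.comp (contDiff_id.sub contDiff_const)).contMDiff.comp h1
    exact h2.mdifferentiableAt (by simp)
  -- The projected position composed with the parametrization is the identity, so the latter has
  -- injective differential.
  have hcomp := mfderiv_comp y hXd hPd
  have hid : mfderiv 𝓘(ℝ, Euc n) 𝓘(ℝ, Euc n)
      ((fun q => π (X q t - X p t)) ∘ fun y => Q (g.symm y)) y = ContinuousLinearMap.id ℝ (Euc n) := by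
    rw [mfderiv_eq_fderiv]
    have : ((fun q => π (X q t - X p t)) ∘ fun y => Q (g.symm y)) =ᶠ[nhds y] id :=
      Filter.eventually_of_mem (hVo.mem_nhds hy) fun y hy => g.right_inv hy.1
    rw [this.fderiv_eq, fderiv_id]
  rw [hid] at hcomp
  intro v w hvw
  have h1 := congrArg (fun l => l v) hcomp
  have h2 := congrArg (fun l => l w) hcomp
  refine h1.trans (Eq.trans ?_ h2.symm)
  exact congrArg (mfderiv (𝓡 n) 𝓘(ℝ, Euc n) (fun q => π (X q t - X p t)) (Q (g.symm y))) hvw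

/-- The graph parametrization is a system of normal coordinates. -/
theorem exists_isNormalAt (h : IsPhiFlow Φ T X ν) {t : ℝ} (ht : t ∈ Set.Ioo 0 T) (p : M)
    {b : Fin n → Euc (n + 1)} (hb : ∀ i j, ⟪b i, b j⟫_ℝ = if i = j then 1 else 0)
    (hbr : ∀ i, ∃ v, diffAt (fun q => X q t) p v = b i) :
    ∃ (P : Euc n → M) (V : Set (Euc n)), IsParametrization P V ∧ (0 : Euc n) ∈ V ∧ P 0 = p ∧
      IsNormalAt (fun z : Euc n × ℝ => X (P z.1) z.2) (0, t) ∧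
      ∀ i, dirDeriv (spaceDir i) (fun z : Euc n × ℝ => X (P z.1) z.2) (0, t) = b i := by
  have ht' := Set.Ioo_subset_Ico_self ht
  obtain ⟨P, V, hP, h0, hP0, hg⟩ := h.exists_graph_parametrization ht' p hb hbr
  have hf := h.coordFlow hP
  set Y : Euc n × ℝ → Euc (n + 1) := fun z => X (P z.1) z.2 with hY
  -- At time `t` the tangential components of `Y` are affine in `y`, so their first derivatives are
  -- constant and their second derivatives vanish: hence no Christoffel symbols at the origin.
  have hone : ∀ y ∈ V, ∀ i k, ⟪dirDeriv (spaceDir i) Y (y, t), b k⟫_ℝ = if i = k then 1 else 0 := by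
    intro y hy i k
    have hz : (y, t) ∈ V ×ˢ Set.Ioo 0 T := ⟨hy, ht⟩
    have hs : ContDiffOn ℝ ∞ (fun z => ⟪Y z, b k⟫_ℝ) (V ×ˢ Set.Ioo 0 T) :=
      hf.smooth.inner ℝ contDiffOn_const
    have h1 := hasDerivAt_comp_line hf.isOpen hs (spaceDir i) (z := (y, t)) (r := 0) (by simpa using hz)
    simp only [zero_smul, add_zero] at h1
    rw [dirDeriv_inner hf.isOpen hz hf.smooth contDiffOn_const, dirDeriv_const, inner_zero_right,
      add_zero] at h1
    have h2 : HasDerivAt (fun s : ℝ => (y + s • EuclideanSpace.single i (1 : ℝ)) k + ⟪X p t, b k⟫_ℝ)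
        (if i = k then 1 else 0) 0 := by
      have h3 := (((hasDerivAt_id (0 : ℝ)).mul_const (if i = k then (1 : ℝ) else 0)).const_add
        (y k)).add_const ⟪X p t, b k⟫_ℝ
      simpa [Pi.single_apply, eq_comm] using h3
    refine h1.unique (h2.congr_of_eventuallyEq ?_)
    filter_upwards [eventually_line_mem hf.isOpen hz (spaceDir i)] with s hs
    have h4 := hg _ hs.1 k
    simp only [Prod.fst_add, Prod.smul_fst, spaceDir, inner_sub_left] at h4
    simp only [hY, spaceDir, Prod.fst_add, Prod.smul_fst, Prod.snd_add, Prod.smul_snd, smul_zero,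
      add_zero]
    linarith
  have hz : ((0 : Euc n), t) ∈ V ×ˢ Set.Ioo 0 T := ⟨h0, ht⟩
  have hNb : ∀ i, ⟪ν p t, b i⟫_ℝ = 0 := fun i => by
    obtain ⟨v, hv⟩ := hbr i
    rw [← hv]
    exact h.normal_orthogonal t ht' p v
  have hN : ⟪ν p t, ν p t⟫_ℝ = 1 := by
    rw [real_inner_self_eq_norm_sq, h.normal_unit t ht', one_pow]
  have hXb : ∀ i, dirDeriv (spaceDir i) Y (0, t) = b i := by
    intro i
    refine ext_inner_right ℝ fun u => ?_
    have h5 := hf.normal_orthogonal _ hz i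
    simp only [hP0] at h5
    rw [inner_eq_sum_of_frame hb hN hNb, inner_eq_sum_of_frame hb hN hNb (b i),
      real_inner_comm (ν p t), h5, real_inner_comm (ν p t) (b i), hNb]
    simp only [hone 0 h0, hb]
  refine ⟨P, V, hP, h0, hP0, ⟨fun i j => ?_, fun i j k => ?_⟩, hXb⟩
  · rw [hXb, hXb, hb]
  · rw [hXb]
    have hs : ContDiffOn ℝ ∞ (fun z => ⟪dirDeriv (spaceDir j) Y z, b k⟫_ℝ) (V ×ˢ Set.Ioo 0 T) :=
      (hf.smooth_D _).inner ℝ contDiffOn_const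
    have h1 := hasDerivAt_comp_line hf.isOpen hs (spaceDir i) (z := (0, t)) (r := 0) (by simpa using hz)
    rw [show ((0 : Euc n), t) + (0 : ℝ) • spaceDir i = (0, t) by simp,
      dirDeriv_inner hf.isOpen hz (hf.smooth_D _) contDiffOn_const, dirDeriv_const,
      inner_zero_right, add_zero] at h1
    refine h1.unique ((hasDerivAt_const 0 (if j = k then (1 : ℝ) else 0)).congr_of_eventuallyEq ?_)
    filter_upwards [eventually_line_mem hf.isOpen hz (spaceDir i)] with s hs
    have := hone _ hs.1 j k
    simpa [spaceDir] using this

end IsPhiFlow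
end Flow
-- Preservation of the curvature bound, and `H` at a spatial maximum.
section Flow

variable {n : ℕ} {M : Type*} [TopologicalSpace M] [ChartedSpace (Euc n) M]
  {Φ : ℝ → ℝ} {T : ℝ} {X ν : M → ℝ → Euc (n + 1)}

/-- At the point `p` and the time `t`, all principal curvatures are greater than `c`. -/
def CurvatureGT (X ν : M → ℝ → Euc (n + 1)) (c t : ℝ) (p : M) : Prop :=
  ∀ v : TangentSpace (𝓡 n) p, v ≠ 0 →
    c * ⟪diffAt (fun q => X q t) p v, diffAt (fun q => X q t) p v⟫_ℝ <
      ⟪diffAt (fun q => ν q t) p v, diffAt (fun q => X q t) p v⟫_ℝ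

/-- At the point `p` and the time `t`, all principal curvatures are at least `c`. -/
def CurvatureGE (X ν : M → ℝ → Euc (n + 1)) (c t : ℝ) (p : M) : Prop :=
  ∀ v : TangentSpace (𝓡 n) p,
    c * ⟪diffAt (fun q => X q t) p v, diffAt (fun q => X q t) p v⟫_ℝ ≤
      ⟪diffAt (fun q => ν q t) p v, diffAt (fun q => X q t) p v⟫_ℝ

theorem CurvatureGT.ge {c t : ℝ} {p : M} (h : CurvatureGT X ν c t p) : CurvatureGE X ν c t p := by
  intro v
  rcases eq_or_ne v 0 with rfl | hv
  · simp
  · exact (h v hv).le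

variable [IsManifold (𝓡 n) ∞ M]

namespace IsPhiFlow

/-- By homogeneity the inequality need only be tested on the compact unit sphere of coordinate
vectors, which makes it an open condition. The constant `c` varies too, so that positivity at time
zero can be improved to a positive lower bound. -/
theorem eventually_curvatureGT (h : IsPhiFlow Φ T X ν) {p : M} {t c : ℝ} (ht : t ∈ Set.Ico 0 T)
    (hp : CurvatureGT X ν c t p) :
    ∀ᶠ x : (M × ℝ) × ℝ in nhds ((p, t), c), x.1.2 ∈ Set.Ico 0 T →
      CurvatureGT X ν x.2 x.1.2 x.1.1 := by
  set P : Euc n → M := fun x => (extChartAt (𝓡 n) p).symm x with hPd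
  set V := (extChartAt (𝓡 n) p).target with hV
  have hP : IsParametrization P V := IsParametrization.extChartAt_symm p
  set y₀ := extChartAt (𝓡 n) p p with hy₀
  have hy : y₀ ∈ V := mem_extChartAt_target p
  have hPy : P y₀ = p := extChartAt_to_inv p
  set S : Set ((Euc n × ℝ) × ℝ) := (V ×ˢ Set.Ico 0 T) ×ˢ Set.univ with hS
  let f : ((Euc n × ℝ) × ℝ) × Euc n → ℝ := fun q =>
    ⟪coordDiff P ν q.1.1 q.2, coordDiff P X q.1.1 q.2⟫_ℝ -
      q.1.2 * ⟪coordDiff P X q.1.1 q.2, coordDiff P X q.1.1 q.2⟫_ℝ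
  have hlin : ∀ F : M → ℝ → Euc (n + 1), ContinuousOn (coordDiff P F) (V ×ˢ Set.Ico 0 T) →
      ContinuousOn (fun q : ((Euc n × ℝ) × ℝ) × Euc n => coordDiff P F q.1.1 q.2)
        (S ×ˢ Set.univ) := by
    intro F hF
    exact (hF.comp (f := fun q : ((Euc n × ℝ) × ℝ) × Euc n => q.1.1) (by fun_prop)
      fun q hq => hq.1.1).clm_apply continuousOn_snd
  have hX := hlin X (hP.contDiffOn_coordDiff h.smooth).continuousOn
  have hν := hlin ν (hP.contDiffOn_coordDiff h.normal_smooth).continuousOn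
  have hf : ContinuousOn f (S ×ˢ Set.univ) :=
    (hν.inner hX).sub ((continuousOn_snd.comp (f := fun q : ((Euc n × ℝ) × ℝ) × Euc n => q.1)
      continuousOn_fst (Set.mapsTo_univ _ _)).mul (hX.inner hX))
  have hmain : ∀ z ∈ V ×ˢ Set.Ico 0 T, ∀ c, (∀ w ∈ Metric.sphere (0 : Euc n) 1, 0 < f ((z, c), w)) ↔
      CurvatureGT X ν c z.2 (P z.1) := by
    intro z hz c
    have hfe : ∀ w, f ((z, c), w) = ⟪diffAt (fun q => ν q z.2) (P z.1) (hP.equiv hz.1 w),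
        diffAt (fun q => X q z.2) (P z.1) (hP.equiv hz.1 w)⟫_ℝ -
        c * ⟪diffAt (fun q => X q z.2) (P z.1) (hP.equiv hz.1 w),
          diffAt (fun q => X q z.2) (P z.1) (hP.equiv hz.1 w)⟫_ℝ := by
      intro w
      simp only [f, h.coordDiff_normal hP hz, h.coordDiff_X hP hz]
    constructor
    · intro hw v hv
      obtain ⟨w, rfl⟩ := (hP.equiv hz.1).surjective v
      have hw0 : w ≠ 0 := fun h0 => hv (by rw [h0, map_zero])
      have hn : ‖w‖ ≠ 0 := norm_ne_zero_iff.2 hw0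
      have h1 := hw (‖w‖⁻¹ • w) (by simp [norm_smul, hn])
      rw [hfe] at h1
      simp only [map_smul, inner_smul_left, inner_smul_right, RCLike.conj_to_real] at h1
      have h2 : 0 < ‖w‖⁻¹ * ‖w‖⁻¹ := by positivity
      rw [← sub_pos]
      refine pos_of_mul_pos_right (a := ‖w‖⁻¹ * ‖w‖⁻¹) ?_ h2.le
      linarith
    · intro hc w hw
      rw [hfe, sub_pos]
      refine hc _ fun h0 => ?_
      rw [LinearEquiv.map_eq_zero_iff] at h0
      simp [h0] at hw
  have hev : ∀ᶠ x : (Euc n × ℝ) × ℝ in nhds ((y₀, t), c), ∀ w ∈ Metric.sphere (0 : Euc n) 1,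
      x ∈ S → 0 < f (x, w) := by
    refine IsCompact.eventually_forall_of_forall_eventually (isCompact_sphere _ _) fun w hw => ?_
    have h0 : 0 < f (((y₀, t), c), w) := by
      refine (hmain (y₀, t) ⟨hy, ht⟩ c).2 ?_ w hw
      simp only [hPy]
      exact hp
    have h1 := (hf (((y₀, t), c), w) ⟨⟨⟨hy, ht⟩, trivial⟩, trivial⟩).eventually (lt_mem_nhds h0)
    rw [eventually_nhdsWithin_iff] at h1
    filter_upwards [h1] with x hx hxS
    exact hx ⟨hxS, trivial⟩
  have hcont : ContinuousAt (fun x : (M × ℝ) × ℝ => ((extChartAt (𝓡 n) p x.1.1, x.1.2), x.2))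
      ((p, t), c) := by
    have h1 : ContinuousAt (fun x : (M × ℝ) × ℝ => extChartAt (𝓡 n) p x.1.1) ((p, t), c) :=
      ContinuousAt.comp (f := fun x : (M × ℝ) × ℝ => x.1.1) (continuousAt_extChartAt p)
        (by fun_prop)
    exact (h1.prodMk (by fun_prop)).prodMk (by fun_prop)
  have hsrc : ∀ᶠ x : (M × ℝ) × ℝ in nhds ((p, t), c), x.1.1 ∈ (extChartAt (𝓡 n) p).source := by
    have h1 : ContinuousAt (fun x : (M × ℝ) × ℝ => x.1.1) ((p, t), c) := by fun_prop
    exact h1.eventually_mem (extChartAt_source_mem_nhds p)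
  filter_upwards [hcont.eventually hev, hsrc] with x hx hxs hxt
  have hxV : extChartAt (𝓡 n) p x.1.1 ∈ V := (extChartAt (𝓡 n) p).map_source hxs
  have h1 := (hmain (extChartAt (𝓡 n) p x.1.1, x.1.2) ⟨hxV, hxt⟩ x.2).1
    fun w hw => hx w hw ⟨⟨hxV, hxt⟩, trivial⟩
  simp only [hPd] at h1
  rwa [(extChartAt (𝓡 n) p).left_inv hxs] at h1

theorem continuousOn_diffAt {F : M → ℝ → Euc (n + 1)}
    (hF : ContMDiffOn ((𝓡 n).prod 𝓘(ℝ, ℝ)) 𝓘(ℝ, Euc (n + 1)) ∞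
      (fun q : M × ℝ => F q.1 q.2) (Set.univ ×ˢ Set.Ico 0 T)) (p : M) (v : TangentSpace (𝓡 n) p) :
    ContinuousOn (fun t => diffAt (fun q => F q t) p v) (Set.Ico 0 T) := by
  have hP := IsParametrization.extChartAt_symm (n := n) p
  have hy := mem_extChartAt_target (I := 𝓡 n) p
  have key : ∀ v : TangentSpace (𝓡 n) ((extChartAt (𝓡 n) p).symm (extChartAt (𝓡 n) p p)),
      ContinuousOn (fun t => diffAt (fun q => F q t) _ v) (Set.Ico 0 T) := by
    intro v
    obtain ⟨w, rfl⟩ := (hP.equiv hy).surjective v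
    have h1 : ContinuousOn (fun t => coordDiff _ F (extChartAt (𝓡 n) p p, t) w) (Set.Ico 0 T) :=
      ((hP.contDiffOn_coordDiff hF).continuousOn.comp (f := fun t => (extChartAt (𝓡 n) p p, t))
        (by fun_prop) fun t ht => ⟨hy, ht⟩).clm_apply continuousOn_const
    refine h1.congr fun t ht => ?_
    exact (hP.coordDiff_apply (z := (extChartAt (𝓡 n) p p, t))
      ((contMDiff_slice hF ht).mdifferentiableAt (by simp)) hy w).symm
  rw [extChartAt_to_inv] at key
  exact key v

theorem isClosed_curvatureGE (h : IsPhiFlow Φ T X ν) (c : ℝ) {t : ℝ} (ht : t < T) :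
    IsClosed ({s | ∀ p, CurvatureGE X ν c s p} ∩ Set.Icc 0 t) := by
  have hsub : Set.Icc 0 t ⊆ Set.Ico 0 T := Set.Icc_subset_Ico_right ht
  have : {s | ∀ p, CurvatureGE X ν c s p} ∩ Set.Icc 0 t =
      Set.Icc 0 t ∩ ⋂ (p : M) (v : TangentSpace (𝓡 n) p), Set.Icc 0 t ∩ (fun s =>
        ⟪diffAt (fun q => ν q s) p v, diffAt (fun q => X q s) p v⟫_ℝ -
        c * ⟪diffAt (fun q => X q s) p v, diffAt (fun q => X q s) p v⟫_ℝ) ⁻¹' Set.Ici 0 := by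
    ext s
    simp only [Set.mem_inter_iff, Set.mem_ofPred_eq, CurvatureGE, Set.mem_iInter, Set.mem_preimage,
      Set.mem_Ici, sub_nonneg]
    exact ⟨fun hs => ⟨hs.2, fun p v => ⟨hs.2, hs.1 p v⟩⟩, fun hs => ⟨fun p v => (hs.2 p v).2, hs.1⟩⟩
  rw [this]
  refine isClosed_Icc.inter (isClosed_iInter fun p => isClosed_iInter fun v => ?_)
  have hX := (continuousOn_diffAt h.smooth p v).mono hsub
  have hν := (continuousOn_diffAt h.normal_smooth p v).mono hsub
  exact ((hν.inner hX).sub (continuousOn_const.mul (hX.inner hX))).preimage_isClosed_of_isClosed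
    isClosed_Icc isClosed_Ici

/-- The maximum principle: a lower bound of the principal curvatures becomes strict. -/
theorem curvatureGT_of_forall_ge (h : IsPhiFlow Φ T X ν) (hΦ : IsSpeed Φ) {c t : ℝ} (hc : 0 < c)
    (ht : t ∈ Set.Ioo 0 T) (hge : ∀ s ∈ Set.Icc 0 t, ∀ p, CurvatureGE X ν c s p) (p : M) :
    CurvatureGT X ν c t p := by
  intro v hv
  have ht' := Set.Ioo_subset_Ico_self ht
  refine lt_of_le_of_ne (hge t ⟨ht.1.le, le_rfl⟩ p v) fun heq => ?_
  have hLv : diffAt (fun q => X q t) p v ≠ 0 := fun h0 =>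
    hv (h.immersion t ht' p (h0.trans (map_zero _).symm))
  have hn : ‖diffAt (fun q => X q t) p v‖ ≠ 0 := norm_ne_zero_iff.2 hLv
  set r := ‖diffAt (fun q => X q t) p v‖⁻¹ with hr
  have hnorm : ‖diffAt (fun q => X q t) p (r • v)‖ = 1 := by
    rw [map_smul, norm_smul, hr, norm_inv, norm_norm, inv_mul_cancel₀ hn]
  have hd : Module.finrank ℝ (LinearMap.range (diffAt (fun q => X q t) p)) = Fintype.card (Fin n) := by
    rw [LinearMap.finrank_range_of_inj (h.immersion t ht' p), finrank_tangentSpace, Fintype.card_fin]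
  have hn0 : 0 < n := by
    have : Nontrivial (TangentSpace (𝓡 n) p) := ⟨v, 0, hv⟩
    have h1 := Module.finrank_pos (R := ℝ) (M := TangentSpace (𝓡 n) p)
    rwa [finrank_tangentSpace] at h1
  let a : Fin n := ⟨0, hn0⟩
  -- The normalized null vector becomes the `a`-th element of an orthonormal tangent frame, so
  -- `not_null` applies to a coordinate direction. The constant family is orthonormal only on `{a}`,
  -- which is all that is extended.
  obtain ⟨b', hb'⟩ := Orthonormal.exists_orthonormalBasis_extension_of_card_eq (𝕜 := ℝ) hd
    (v := fun _ : Fin n => (⟨_, LinearMap.mem_range_self (diffAt (fun q => X q t) p) (r • v)⟩ :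
      LinearMap.range (diffAt (fun q => X q t) p))) (s := {a})
    ⟨fun i => hnorm, fun i j hij => (hij (Subsingleton.elim i j)).elim⟩
  have hba : ((b' a : LinearMap.range (diffAt (fun q => X q t) p)) : Euc (n + 1)) =
      diffAt (fun q => X q t) p (r • v) := by
    rw [hb' a rfl]
  obtain ⟨P, V, hP, h0, hP0, hN, hXb⟩ := h.exists_isNormalAt ht p
    (b := fun i => (b' i : Euc (n + 1)))
    (fun i j => by simpa using orthonormal_iff_ite.1 b'.orthonormal i j) (fun i => (b' i).2)
  have hz : ((0 : Euc n), t) ∈ V ×ˢ Set.Ioo 0 T := ⟨h0, ht⟩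
  have hsub : V ×ˢ Set.Ioo 0 T ⊆ V ×ˢ Set.Ico 0 T := Set.prod_mono_right Set.Ioo_subset_Ico_self
  refine (h.coordFlow hP).not_null hΦ hz hN a hc (fun y hy hyt w => ?_) ?_
  · rw [dirDeriv_eq_coordDiff hP h.smooth hy, dirDeriv_eq_coordDiff hP h.normal_smooth hy,
      h.coordDiff_X hP (hsub hy), h.coordDiff_normal hP (hsub hy)]
    exact hge y.2 ⟨hy.2.1.le, hyt⟩ _ _
  · have hXa := hXb a
    rw [hba] at hXa
    clear hba hb' hXb
    have e1 : dirDeriv (spaceDir a) (fun z : Euc n × ℝ => X (P z.1) z.2) (0, t) =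
        diffAt (fun q => X q t) (P 0) (hP.equiv h0 (EuclideanSpace.single a 1)) :=
      (dirDeriv_eq_coordDiff hP h.smooth hz _).trans (h.coordDiff_X hP (hsub hz) _)
    have e2 : dirDeriv (spaceDir a) (fun z : Euc n × ℝ => ν (P z.1) z.2) (0, t) =
        diffAt (fun q => ν q t) (P 0) (hP.equiv h0 (EuclideanSpace.single a 1)) :=
      (dirDeriv_eq_coordDiff hP h.normal_smooth hz _).trans (h.coordDiff_normal hP (hsub hz) _)
    subst hP0
    rw [e1] at hXa
    have e3 := h.immersion t ht' _ hXa
    rw [e1, e2, e3, map_smul, map_smul, inner_smul_left, inner_smul_right, inner_smul_left,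
      inner_smul_right, ← heq]
    ring

/-- Continuous induction in time: `κ ≥ c` is a closed condition; if it holds up to `s`, it is strict
at `s` (at `s = 0` by the choice of `c`), hence by openness and compactness of `M` it holds slightly
beyond `s`. -/
theorem exists_curvatureGE [CompactSpace M] (h : IsPhiFlow Φ T X ν) (hΦ : IsSpeed Φ) (hT : 0 < T)
    (hconv : IsStrictlyConvex (fun q => X q 0) (fun q => ν q 0)) :
    ∃ c > 0, ∀ t ∈ Set.Ico 0 T, ∀ p, CurvatureGE X ν c t p := by
  have h00 : (0 : ℝ) ∈ Set.Ico 0 T := ⟨le_rfl, hT⟩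
  have hstart : ∀ p, CurvatureGT X ν 0 0 p := fun p v hv => by
    rw [zero_mul]
    exact inner_pos_of_eigenvalues_pos (h.immersion 0 h00 p) (h.diffAt_weingarten h00 p)
      (h.inner_diffAt_comm h00 p) (hconv p) hv
  have hcev : ∀ᶠ c : ℝ in nhds 0, ∀ p ∈ (Set.univ : Set M), CurvatureGT X ν c 0 p := by
    refine isCompact_univ.eventually_forall_of_forall_eventually fun p _ => ?_
    have h1 : ContinuousAt (fun x : ℝ × M => ((x.2, (0 : ℝ)), x.1)) (0, p) := by fun_prop
    filter_upwards [h1.eventually (h.eventually_curvatureGT h00 (hstart p))] with x hx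
    exact hx h00
  obtain ⟨c, hcs, hc⟩ := ((hcev.filter_mono (nhdsWithin_le_nhds (s := Set.Ioi 0))).and
    self_mem_nhdsWithin).exists
  have hc : 0 < c := hc
  refine ⟨c, hc, fun t ht => ?_⟩
  have hsub := (h.isClosed_curvatureGE c ht.2).Icc_subset_of_forall_mem_nhdsGT_of_Icc_subset
    (fun p => (hcs p trivial).ge) (fun s hs hsS => ?_)
  · exact hsub ⟨ht.1, le_rfl⟩
  · have hsT : s ∈ Set.Ico 0 T := ⟨hs.1, hs.2.trans ht.2⟩
    have hgt : ∀ p, CurvatureGT X ν c s p := by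
      rcases hs.1.eq_or_lt with rfl | hs0
      · exact fun p => hcs p trivial
      · exact h.curvatureGT_of_forall_ge hΦ hc ⟨hs0, hsT.2⟩ fun s' hs' => hsS hs'
    have hev : ∀ᶠ s' : ℝ in nhds s, ∀ p ∈ (Set.univ : Set M), s' ∈ Set.Ico 0 T →
        CurvatureGT X ν c s' p := by
      refine isCompact_univ.eventually_forall_of_forall_eventually fun p _ => ?_
      have h1 : ContinuousAt (fun x : ℝ × M => ((x.2, x.1), c)) (s, p) := by fun_prop
      exact h1.eventually (h.eventually_curvatureGT hsT (hgt p))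
    filter_upwards [hev.filter_mono nhdsWithin_le_nhds, Ioo_mem_nhdsGT hsT.2] with s' h1 h2 p
    exact (h1 p trivial ⟨hs.1.trans h2.1.le, h2.2⟩).ge

theorem trace_weingarten_sq_le [CompactSpace M] (h : IsPhiFlow Φ T X ν) (hΦ : IsSpeed Φ)
    (hT : 0 < T) (hconv : IsStrictlyConvex (fun q => X q 0) (fun q => ν q 0)) {t : ℝ}
    (ht : t ∈ Set.Ico 0 T) (p : M) :
    LinearMap.trace ℝ (TangentSpace (𝓡 n) p)
        (weingarten (fun q => X q t) (fun q => ν q t) p ∘ₗ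
          weingarten (fun q => X q t) (fun q => ν q t) p) ≤
      meanCurvature (fun q => X q t) (fun q => ν q t) p ^ 2 := by
  obtain ⟨c, hc, hge⟩ := h.exists_curvatureGE hΦ hT hconv
  exact trace_comp_self_le (h.immersion t ht p) (h.diffAt_weingarten ht p)
    (h.inner_diffAt_comm ht p)
    fun v => (mul_nonneg hc.le real_inner_self_nonneg).trans (hge t ht p v)

theorem continuousOn_meanCurvature (h : IsPhiFlow Φ T X ν) :
    ContinuousOn (fun q : M × ℝ => meanCurvature (fun p => X p q.2) (fun p => ν p q.2) q.1)
      (Set.univ ×ˢ Set.Ico 0 T) := by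
  rintro ⟨p, t⟩ hpt
  have hP := IsParametrization.extChartAt_symm (n := n) p
  have h1 : ContinuousOn (fun z => ∑ j, coordWeingarten (extChartAt (𝓡 n) p).symm X ν z
      (EuclideanSpace.single j 1) j) ((extChartAt (𝓡 n) p).target ×ˢ Set.Ico 0 T) := by
    refine continuousOn_finsetSum _ fun j _ => ?_
    exact (EuclideanSpace.proj j : Euc n →L[ℝ] ℝ).continuous.comp_continuousOn
      ((h.contDiffOn_coordWeingarten hP).continuousOn.clm_apply continuousOn_const)
  have h2 : ContinuousOn (fun q : M × ℝ => (extChartAt (𝓡 n) p q.1, q.2))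
      ((extChartAt (𝓡 n) p).source ×ˢ Set.Ico 0 T) :=
    ((continuousOn_extChartAt p).comp continuousOn_fst fun q hq => hq.1).prodMk continuousOn_snd
  have h3 := h1.comp h2 fun q hq => ⟨(extChartAt (𝓡 n) p).map_source hq.1, hq.2⟩
  have h4 : ContinuousOn
      (fun q : M × ℝ => meanCurvature (fun p => X p q.2) (fun p => ν p q.2) q.1)
      ((extChartAt (𝓡 n) p).source ×ˢ Set.Ico 0 T) := by
    refine h3.congr fun q hq => ?_
    have h5 := h.meanCurvature_eq hP (z := (extChartAt (𝓡 n) p q.1, q.2))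
      ⟨(extChartAt (𝓡 n) p).map_source hq.1, hq.2⟩
    rwa [(extChartAt (𝓡 n) p).left_inv hq.1] at h5
  refine (h4 (p, t) ⟨mem_extChartAt_source p, hpt.2⟩).mono_of_mem_nhdsWithin ?_
  rw [nhdsWithin_prod_eq, nhdsWithin_univ]
  exact Filter.prod_mem_prod (extChartAt_source_mem_nhds p) self_mem_nhdsWithin

/-- The evolution of the mean curvature at a spatial maximum. -/
theorem exists_hasDerivAt_meanCurvature (h : IsPhiFlow Φ T X ν) (hΦ : IsSpeed Φ) {t : ℝ}
    (ht : t ∈ Set.Ioo 0 T) {p : M}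
    (hmax : ∀ q, meanCurvature (fun q => X q t) (fun q => ν q t) q ≤
      meanCurvature (fun q => X q t) (fun q => ν q t) p) :
    ∃ d, HasDerivAt (fun s => meanCurvature (fun q => X q s) (fun q => ν q s) p) d t ∧
      d ≤ Φ (meanCurvature (fun q => X q t) (fun q => ν q t) p) *
        LinearMap.trace ℝ (TangentSpace (𝓡 n) p)
          (weingarten (fun q => X q t) (fun q => ν q t) p ∘ₗ
            weingarten (fun q => X q t) (fun q => ν q t) p) := by
  have ht' := Set.Ioo_subset_Ico_self ht
  have hd : Module.finrank ℝ (LinearMap.range (diffAt (fun q => X q t) p)) = n := by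
    rw [LinearMap.finrank_range_of_inj (h.immersion t ht' p), finrank_tangentSpace]
  let b := (stdOrthonormalBasis ℝ (LinearMap.range (diffAt (fun q => X q t) p))).reindex
    (finCongr hd)
  obtain ⟨P, V, hP, h0, hP0, hN, -⟩ := h.exists_isNormalAt ht p
    (b := fun i => (b i : Euc (n + 1)))
    (fun i j => by simpa using orthonormal_iff_ite.1 b.orthonormal i j) (fun i => (b i).2)
  clear b
  have hz : ((0 : Euc n), t) ∈ V ×ˢ Set.Ioo 0 T := ⟨h0, ht⟩
  have hsub : V ×ˢ Set.Ioo 0 T ⊆ V ×ˢ Set.Ico 0 T := Set.prod_mono_right Set.Ioo_subset_Ico_self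
  have hf := h.coordFlow hP
  have hle := hf.Dt_meanCurvature_le hΦ hz hN (by
    rintro ⟨y, s⟩ hy hys
    obtain rfl : s = t := hys
    have e1 := h.meanCurvature_eq hP (hsub hy)
    have e2 := h.meanCurvature_eq hP (hsub hz)
    rw [← e1, ← e2, hP0]
    exact hmax _)
  rw [← h.meanCurvature_eq hP (hsub hz), ← h.trace_weingarten_sq_eq hP (hsub hz)] at hle
  subst hP0
  refine ⟨_, ?_, hle⟩
  -- The line starts at time `0` so that its parameter is time itself; only its point at `r = t` has
  -- to lie in the domain.
  have h1 := hasDerivAt_comp_line hf.isOpen hf.smooth_H timeDir (z := ((0 : Euc n), (0 : ℝ)))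
    (r := t) (by simpa [timeDir] using hz)
  have e : ∀ s : ℝ, ((0 : Euc n), (0 : ℝ)) + s • timeDir = (0, s) := fun s => by simp [timeDir]
  simp only [e] at h1
  refine h1.congr_of_eventuallyEq ?_
  filter_upwards [Ioo_mem_nhds ht.1 ht.2] with s hs
  exact h.meanCurvature_eq hP (z := (0, s)) (hsub ⟨h0, hs⟩)

end IsPhiFlow
end Flow

/-! ### Monotonicity and derivative of `G`. -/

namespace IsSpeed

variable {Φ : ℝ → ℝ}

theorem strictMonoOn_speedG (h : IsSpeed Φ) : StrictMonoOn (speedG Φ) (Set.Ici 0) := by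
  intro a ha b hb hab
  rcases (Set.mem_Ici.1 ha).eq_or_lt with rfl | ha
  · rw [show speedG Φ 0 = 0 by simp [speedG]]
    exact h.speedG_pos hab
  · have h1 := h.le_speedG_sub ha hab.le
    have h2 : 0 < (b - a) * (1 / Φ (1 / a)) := mul_pos (sub_pos.2 hab) (h.integrand_pos ha)
    linarith

theorem hasDerivAt_speedG (h : IsSpeed Φ) {x : ℝ} (hx : 0 < x) :
    HasDerivAt (speedG Φ) (1 / Φ (1 / x)) x := by
  have hc : ContinuousOn (fun s => 1 / Φ (1 / s)) (Set.Ioi 0) := by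
    have h1 : ContinuousOn (fun s : ℝ => 1 / s) (Set.Ioi 0) :=
      continuousOn_const.div continuousOn_id fun s hs => ne_of_gt hs
    have h2 : Set.MapsTo (fun s : ℝ => 1 / s) (Set.Ioi 0) (Set.Ioi 0) := fun s hs =>
      Set.mem_Ioi.2 (one_div_pos.2 hs)
    exact continuousOn_const.div (h.smooth.continuousOn.comp h1 h2)
      fun s hs => (h.pos _ (h2 hs)).ne'
  exact intervalIntegral.integral_hasDerivAt_right (h.integrable le_rfl hx.le)
    (hc.stronglyMeasurableAtFilter isOpen_Ioi x hx) (hc.continuousAt (Ioi_mem_nhds hx))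

end IsSpeed

/-! ### Comparison for `G(1/H)` and the main theorem. -/

section Flow

variable {n : ℕ} {M : Type*} [TopologicalSpace M] [CompactSpace M] [ChartedSpace (Euc n) M]
  [IsManifold (𝓡 n) ∞ M] {Φ : ℝ → ℝ} {T : ℝ} {X ν : M → ℝ → Euc (n + 1)}

/-- At a spatial maximum of `H`, `∂ₜ G(1/H) = -∂ₜ H / (Φ(H) H²) ≥ -1`, so the spatial minimum of
`G(1/H) + t` cannot drop below its initial value. -/
theorem IsPhiFlow.speedG_le (h : IsPhiFlow Φ T X ν) (hΦ : IsSpeed Φ) (hT : 0 < T)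
    (hconv : IsStrictlyConvex (fun q => X q 0) (fun q => ν q 0)) {t : ℝ}
    (ht : t ∈ Set.Ico 0 T) (p : M) :
    speedG Φ (1 / ⨆ q, meanCurvature (fun q => X q 0) (fun q => ν q 0) q) ≤
      speedG Φ (1 / meanCurvature (fun q => X q t) (fun q => ν q t) p) + t := by
  set H : M → ℝ → ℝ := fun q s => meanCurvature (fun q => X q s) (fun q => ν q s) q with hH
  change speedG Φ (1 / ⨆ q, H q 0) ≤ speedG Φ (1 / H p t) + t
  have hHpos : ∀ s ∈ Set.Ico 0 T, ∀ q, 0 < H q s := h.meanCurvature_pos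
  have h00 : (0 : ℝ) ∈ Set.Ico 0 T := ⟨le_rfl, hT⟩
  have hsub : Set.Icc 0 t ⊆ Set.Ico 0 T := Set.Icc_subset_Ico_right ht.2
  have hHc : ContinuousOn (fun q : M × ℝ => H q.1 q.2) (Set.univ ×ˢ Set.Ico 0 T) :=
    h.continuousOn_meanCurvature
  have hbdd : BddAbove (Set.range fun q => H q 0) := by
    have h1 : Continuous fun q => H q 0 := by
      rw [← continuousOn_univ]
      exact hHc.comp (f := fun q => (q, (0 : ℝ))) (by fun_prop) fun q _ => ⟨trivial, h00⟩
    exact (isCompact_range h1).bddAbove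
  -- The slope `1 + ε` makes the time derivative at least `ε > 0` at an interior minimum, whereas
  -- minimality over earlier times makes it nonpositive. The minimum of `f` is therefore at time
  -- zero.
  have hε : ∀ ε > 0, speedG Φ (1 / ⨆ q, H q 0) ≤ speedG Φ (1 / H p t) + (1 + ε) * t := by
    intro ε hε
    let f : M × ℝ → ℝ := fun q => speedG Φ (1 / H q.1 q.2) + (1 + ε) * q.2
    have hf : ContinuousOn f (Set.univ ×ˢ Set.Icc 0 t) := by
      have h1 := hHc.mono (Set.prod_mono_right hsub)
      have h2 : ContinuousOn (fun q : M × ℝ => 1 / H q.1 q.2) (Set.univ ×ˢ Set.Icc 0 t) :=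
        continuousOn_const.div h1 fun q hq => (hHpos _ (hsub hq.2) _).ne'
      have h3 : ContinuousOn (speedG Φ) (Set.Ioi 0) := fun x hx =>
        (hΦ.hasDerivAt_speedG hx).continuousAt.continuousWithinAt
      exact (h3.comp h2 fun q hq => one_div_pos.2 (hHpos _ (hsub hq.2) _)).add (by fun_prop)
    obtain ⟨⟨p₀, s⟩, ⟨-, hs⟩, hmin⟩ := (isCompact_univ.prod isCompact_Icc).exists_isMinOn
      ⟨(p, t), trivial, ht.1, le_rfl⟩ hf
    have hmin : ∀ q, ∀ s' ∈ Set.Icc 0 t, f (p₀, s) ≤ f (q, s') := fun q s' hs' =>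
      hmin (show (q, s') ∈ Set.univ ×ˢ Set.Icc 0 t from ⟨trivial, hs'⟩)
    have hs : s ∈ Set.Icc 0 t := hs
    rcases hs.1.eq_or_lt with rfl | hs0
    · refine le_trans ?_ (hmin p t ⟨ht.1, le_rfl⟩)
      simp only [f, mul_zero, add_zero]
      have h1 : H p₀ 0 ≤ ⨆ q, H q 0 := le_ciSup hbdd p₀
      have h2 := hHpos 0 h00 p₀
      exact hΦ.strictMonoOn_speedG.monotoneOn
        (Set.mem_Ici.2 (one_div_nonneg.2 (h2.le.trans h1))) (Set.mem_Ici.2 (one_div_nonneg.2 h2.le))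
        (one_div_le_one_div_of_le h2 h1)
    · exfalso
      have hsT : s ∈ Set.Ioo 0 T := ⟨hs0, hs.2.trans_lt ht.2⟩
      have hsT' := Set.Ioo_subset_Ico_self hsT
      have hH0 := hHpos s hsT' p₀
      obtain ⟨d, hd, hdle⟩ := h.exists_hasDerivAt_meanCurvature hΦ hsT (p := p₀) fun q => by
        have h1 := hmin q s hs
        simp only [f, add_le_add_iff_right] at h1
        have hq := hHpos s hsT' q
        rw [hΦ.strictMonoOn_speedG.le_iff_le (Set.mem_Ici.2 (one_div_nonneg.2 hH0.le))
          (Set.mem_Ici.2 (one_div_nonneg.2 hq.le)), one_div_le_one_div hH0 hq] at h1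
        exact h1
      have hd : HasDerivAt (fun s => H p₀ s) d s := hd
      have hdle : d ≤ Φ (H p₀ s) * H p₀ s ^ 2 := hdle.trans
        (mul_le_mul_of_nonneg_left (h.trace_weingarten_sq_le hΦ hT hconv hsT' p₀)
          (hΦ.pos _ hH0).le)
      have hinv : HasDerivAt (fun s => 1 / H p₀ s) (-d / H p₀ s ^ 2) s := by
        simpa [one_div] using hd.fun_inv hH0.ne'
      have hG := (hΦ.hasDerivAt_speedG (one_div_pos.2 hH0)).comp s hinv
      rw [one_div_one_div] at hG
      have hfd : HasDerivAt (fun s => f (p₀, s))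
          (1 / Φ (H p₀ s) * (-d / H p₀ s ^ 2) + (1 + ε) * 1) s :=
        hG.add ((hasDerivAt_id s).const_mul (1 + ε))
      have hle := hfd.nonpos_of_left_min (by
        filter_upwards [Ioo_mem_nhdsLT hs0] with s' hs'
        exact hmin p₀ s' ⟨hs'.1.le, hs'.2.le.trans hs.2⟩)
      have hΦ0 := hΦ.pos _ hH0
      have h3 : 1 / Φ (H p₀ s) * (-d / H p₀ s ^ 2) = -(d / (Φ (H p₀ s) * H p₀ s ^ 2)) := by
        field_simp
      have h4 : d / (Φ (H p₀ s) * H p₀ s ^ 2) ≤ 1 := (div_le_one (by positivity)).2 hdle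
      linarith
  refine le_of_forall_pos_le_add fun δ hδ => ?_
  rcases ht.1.eq_or_lt with h0 | h0
  · have := hε 1 one_pos
    rw [← h0] at this ⊢
    linarith
  · have := hε (δ / t) (by positivity)
    have h5 : (1 + δ / t) * t = t + δ := by field_simp
    linarith

end Flow

end

theorem mainTheorem8 {n : ℕ} {M : Type*} [TopologicalSpace M] [T2Space M] [CompactSpace M]
    [ChartedSpace (Euc n) M] [IsManifold (𝓡 n) ∞ M]
    (Φ : ℝ → ℝ) (hΦ : IsSpeed Φ) (T : ℝ) (hT : 0 < T) (X ν : M → ℝ → Euc (n + 1))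
    (hflow : IsPhiFlow Φ T X ν)
    (hconv : IsStrictlyConvex (fun q => X q 0) (fun q => ν q 0)) :
    ∀ t ∈ Set.Ico 0 T, ∀ p : M,
      normA (fun q => X q t) (fun q => ν q t) p ≤
          meanCurvature (fun q => X q t) (fun q => ν q t) p ∧
        (t < speedG Φ (1 / ⨆ q, meanCurvature (fun q => X q 0) (fun q => ν q 0) q) →
          meanCurvature (fun q => X q t) (fun q => ν q t) p ≤
            1 / speedGInv Φ
              (speedG Φ (1 / ⨆ q, meanCurvature (fun q => X q 0) (fun q => ν q 0) q) - t)) := by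
  intro t ht p
  have hH := hflow.meanCurvature_pos t ht p
  refine ⟨?_, fun hlt => ?_⟩
  · exact Real.sqrt_le_iff.2 ⟨hH.le, hflow.trace_weingarten_sq_le hΦ hT hconv ht p⟩
  · have hle := hflow.speedG_le hΦ hT hconv ht p
    set y := speedG Φ (1 / ⨆ q, meanCurvature (fun q => X q 0) (fun q => ν q 0) q) - t with hy
    have hy0 : 0 < y := sub_pos.2 hlt
    have hG := hΦ.speedG_speedGInv hy0.le
    have hmem : 0 ≤ speedGInv Φ y := Function.invFunOn_mem (hΦ.bijOn_speedG.surjOn hy0.le)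
    -- `G(0) = 0 < y` excludes the value zero, so the reciprocal is meaningful.
    have hpos : 0 < speedGInv Φ y := by
      refine hmem.lt_of_ne fun h0 => ?_
      rw [← h0] at hG
      simp [speedG] at hG
      linarith
    have h1 : speedGInv Φ y ≤ 1 / meanCurvature (fun q => X q t) (fun q => ν q t) p := by
      rw [← hΦ.strictMonoOn_speedG.le_iff_le hmem (Set.mem_Ici.2 (one_div_nonneg.2 hH.le)), hG]
      linarith
    rwa [le_one_div hH hpos]
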